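/- **Setting.** Use field-aligned coordinates $R=(x,y,z)$ on a box, with $dR=dx\,dy\,dz$, $z$ parallel to the unit vector $\hat b=e_z$ of the equilibrium field $\mathbf B=B\hat b$, and $\nabla_\perp=(\partial_x,\partial_y)$. The functions $B>0$, $\nabla\times\hat b$ (a given equilibrium vector field, with $\hat b\cdot\nabla\times\hat b=0$) and $n_{0s}$ are continuous and time independent; $B$ and $\nabla\times\hat b$ are periodic in the periodic directions. There are finitely many species $s$ with mass $m_s>0$ and charge $q_s\ne0$, and $\mu_0>0$. Write $dw=(2\pi/m_s)\,dv_\parallel d\mu$, $\mathcal J=B^*_\parallel=B$, $\epsilon_\perp=\sum_s m_sn_{0s}/B^2$, $\mathbf B^*=B\hat b+\frac{m_sv_\parallel}{q_s}\nabla\times\hat b+\nabla A_{\parallel h}\times\hat b$ and $$\{F,G\}=\frac{\mathbf B^*}{m_sB}\cdot\Big(\nabla F\,\partial_{v_\parallel}G-\partial_{v_\parallel}F\,\nabla G\Big)-\frac{1}{q_sB}\,(\hat b\times\nabla F)\cdot\nabla G .$$ **Discrete spaces.** Take a structured mesh of configuration space, each of whose directions is periodic or not, and for each species a structured mesh in $(v_\parallel,\mu)$.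 Their products are the phase-space cells $\mathcal K$. Let $\mathbf P$ be any finite-dimensional space of polynomials in $(x,y,z,v_\parallel,\mu)$. $\mathcal V_h$ is the space of functions that lie in $\mathbf P$ on each phase-space cell, and $\overline{\mathcal V}_h\subset\mathcal V_h$ is the subspace of functions continuous across all cell interfaces (including periodic ones). $\mathcal X_h$ is the space of piecewise polynomials in $(x,y,z)$ that lie in $\mathbf P$ on each cell; $\widehat{\mathcal X}_h\subset\mathcal X_h$ is the subspace continuous in $z$, and $\widetilde{\mathcal X}_h\subset\mathcal X_h$ the subspace continuous in $x$ and $y$ (possibly discontinuous in $z$). On each non-periodic wall orthogonal to $x$ or $y$, each potential satisfies either the homogeneous Dirichlet condition, which is then included in its space $\widetilde{\mathcal X}_h^{\phi}$ or $\widetilde{\mathcal X}_h^{A}$, or the natural condition. Let $\mathcal P_z$ be a linear projection of the piecewise polynomials in $(x,y,z)$ onto $\widehat{\mathcal X}_h$ (for instance the one-dimensional finite-element smoothing, i.e. the $L^2$ projection column by column), and let $\mathcal P_z^*[F]\in\mathcal X_h$ be its adjoint: $\int F\,\mathcal P_z[g]\,dR=\int\mathcal P_z^*[F]\,g\,dR$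 for all $g\in\mathcal X_h$ and all integrable $F$. Let $(v_\parallel^2)_h\in\overline{\mathcal V}_h$ be the image of $v_\parallel^2$ under a linear projection onto $\overline{\mathcal V}_h$, and let $B_h$ be a piecewise polynomial in $(x,y,z)$. **Semi-discrete scheme** (no collisions, no sources). The unknowns $f_{s,h}(t)\in\mathcal V_h$, $\tilde\phi_h(t)\in\widetilde{\mathcal X}_h^{\phi}$ and $A_{\parallel h}(t)\in\widetilde{\mathcal X}_h^{A}$ are differentiable in $t$ on a time interval $I$. Put $$H_{s,h}=\tfrac12m_s(v_\parallel^2)_h+\mu B_h+q_s\mathcal P_z[\tilde\phi_h],\qquad \dot R_h=\{R,H_{s,h}\},\qquad \dot v_h=\{v_\parallel,H_{s,h}\}-\frac{q_s}{m_s}\partial_tA_{\parallel h},$$ $$\sigma_h=\sum_sq_s\int\mathcal J f_{s,h}\,dw,\qquad J_{\parallel h}=\sum_s\frac{q_s}{m_s}\int\mathcal J\,\frac{\partial H_{s,h}}{\partial v_\parallel}f_{s,h}\,dw .$$ For all $t\in I$: 1. For every species, every phase-space cell $\mathcal K=\mathcal K^R\times\mathcal K^v$ and every $\psi\in\mathbf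 P$, $$\int_{\mathcal K}\!\psi\,\partial_t(\mathcal Jf_{s,h})\,dR\,dw+\oint_{\partial\mathcal K^R}\!\int_{\mathcal K^v}\!\psi^-\,\widehat{\mathcal Jf_{s,h}}\;\dot R_h\cdot ds_R\,dw+\int_{\mathcal K^R}\!\oint_{\partial\mathcal K^v}\!\dot v_h\,\psi^-\,\widehat{\mathcal Jf_{s,h}}\,ds_w\,dR-\int_{\mathcal K}\!\mathcal Jf_{s,h}\big(\dot R_h\cdot\nabla\psi+\dot v_h\,\partial_{v_\parallel}\psi\big)dR\,dw=0,$$ where $ds_w=\pm(2\pi/m_s)\,d\mu$ on the faces orthogonal to $v_\parallel$, and $\psi$, $\dot R_h$, $\dot v_h$ are evaluated from inside $\mathcal K$ on the faces. The numerical flux $\widehat{\mathcal Jf_{s,h}}$ is arbitrary, except that it takes a single value at each cell interface (including periodic ones) and vanishes on the non-periodic part of the boundary (where the distribution function vanishes). 2. $\displaystyle\int\epsilon_\perp\nabla_\perp\tilde\phi_h\cdot\nabla_\perp\xi\,dR=\int\xi\,\mathcal P_z^*[\sigma_h]\,dR$ for all $\xi\in\widetilde{\mathcal X}_h^{\phi}$.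 3. $\displaystyle\int\nabla_\perp A_{\parallel h}\cdot\nabla_\perp\varphi\,dR=\mu_0\int\varphi\,J_{\parallel h}\,dR$ for all $\varphi\in\widetilde{\mathcal X}_h^{A}$. **Proposition.** If the discrete Hamiltonians are continuous across cell interfaces, $H_{s,h}(t)\in\overline{\mathcal V}_h$ for all $s$ and all $t\in I$, then the scheme exactly conserves the discrete total energy $W_h=W_{Hh}-W_{Eh}+W_{Bh}$, where $$W_{Hh}=\sum_s\int\mathcal Jf_{s,h}H_{s,h}\,dR\,dw,\qquad W_{Eh}=\int\frac{\epsilon_\perp}2|\nabla_\perp\tilde\phi_h|^2\,dR,\qquad W_{Bh}=\int\frac1{2\mu_0}|\nabla_\perp A_{\parallel h}|^2\,dR .$$ That is, $dW_h/dt=0$ on $I$ and $W_h$ is constant on $I$, whatever the choice of numerical flux. -/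

import Mathlib

namespace EMGK

noncomputable section

/-! ### Structured mesh -/

/-- A one-dimensional grid with `n ≥ 1` cells; cell `i` is `[node i, node (i+1)]`. -/
structure Grid where
  n : ℕ
  n_pos : 0 < n
  node : Fin (n + 1) → ℝ
  node_strictMono : StrictMono node

/-- The two ends of a cell in a given direction. -/
inductive Side where
  | lo : Side
  | hi : Side

/-- Lower or upper end of the cell `i`. -/
def Grid.edge (g : Grid) (i : Fin g.n) : Side → ℝ
  | Side.lo => g.node i.castSucc
  | Side.hi => g.node i.succ

/-- Lower or upper end of the whole grid. -/
def Grid.wall (g : Grid) : Side → ℝ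
  | Side.lo => g.node 0
  | Side.hi => g.node (Fin.last g.n)

/-- `g.Next per i j`: the upper end of cell `i` is glued to the lower end of cell `j`. If `per`
holds, the grid is periodic: the last cell is followed by the first one. -/
def Grid.Next (g : Grid) (per : Prop) (i j : Fin g.n) : Prop :=
  (i : ℕ) + 1 = (j : ℕ) ∨ (per ∧ (i : ℕ) + 1 = g.n ∧ (j : ℕ) = 0)

/-- Phase-space mesh for a set `S` of species: a configuration-space grid in the directions
`0, 1, 2` (that is `x, y, z`), each of which may be periodic, and for each species a grid in the
parallel velocity and a grid in the magnetic moment (these are never periodic). -/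
structure Mesh (S : Type*) where
  grid : Fin 3 → Grid
  periodic : Fin 3 → Prop
  vGrid : S → Grid
  muGrid : S → Grid

variable {S : Type*}

/-- Configuration-space cells. -/
abbrev Mesh.CCell (M : Mesh S) : Type := (d : Fin 3) → Fin (M.grid d).n

/-- Velocity-space cells of species `s`; phase-space cells are pairs of a configuration-space cell
and a velocity-space cell. -/
abbrev Mesh.VCell (M : Mesh S) (s : S) : Type := Fin (M.vGrid s).n × Fin (M.muGrid s).n

/-- The closed configuration-space cell. -/
def Mesh.cbox (M : Mesh S) (c : M.CCell) : Set (Fin 3 → ℝ) :=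
  Set.Icc (fun d => (M.grid d).edge (c d) Side.lo) (fun d => (M.grid d).edge (c d) Side.hi)

/-- The closed velocity-space cell, with coordinates `(v_∥, μ)`. -/
def Mesh.vbox (M : Mesh S) {s : S} (k : M.VCell s) : Set (ℝ × ℝ) :=
  Set.Icc ((M.vGrid s).edge k.1 Side.lo) ((M.vGrid s).edge k.1 Side.hi) ×ˢ
    Set.Icc ((M.muGrid s).edge k.2 Side.lo) ((M.muGrid s).edge k.2 Side.hi)

/-- Range of the `μ` coordinate in a velocity-space cell. -/
def Mesh.muBox (M : Mesh S) {s : S} (k : M.VCell s) : Set ℝ :=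
  Set.Icc ((M.muGrid s).edge k.2 Side.lo) ((M.muGrid s).edge k.2 Side.hi)

/-- Range of the `v_∥` coordinate in a velocity-space cell. -/
def Mesh.vparBox (M : Mesh S) {s : S} (k : M.VCell s) : Set ℝ :=
  Set.Icc ((M.vGrid s).edge k.1 Side.lo) ((M.vGrid s).edge k.1 Side.hi)

/-- The two remaining coordinates on the faces of `c` that are orthogonal to direction `d`. -/
def Mesh.cface (M : Mesh S) (c : M.CCell) (d : Fin 3) : Set (Fin 2 → ℝ) :=
  Set.Icc (fun j => (M.grid (d.succAbove j)).edge (c (d.succAbove j)) Side.lo)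
    (fun j => (M.grid (d.succAbove j)).edge (c (d.succAbove j)) Side.hi)

/-- The closed configuration-space domain. -/
def Mesh.domain (M : Mesh S) : Set (Fin 3 → ℝ) :=
  Set.Icc (fun d => (M.grid d).wall Side.lo) (fun d => (M.grid d).wall Side.hi)

/-- The point of configuration space whose coordinate `d` is `a` and whose other two coordinates
are `y`. -/
def atFace (d : Fin 3) (a : ℝ) (y : Fin 2 → ℝ) : Fin 3 → ℝ :=
  Fin.insertNth (α := fun _ => ℝ) d a y

/-- Phase-space coordinates `(x, y, z, v_∥, μ)`. -/
def pt (R : Fin 3 → ℝ) (w : ℝ × ℝ) : Fin 5 → ℝ := ![R 0, R 1, R 2, w.1, w.2]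

/-! ### Discrete function spaces

A discrete function is a family of polynomials, one for each cell. -/

/-- Polynomials on configuration space. -/
abbrev Poly3 : Type := MvPolynomial (Fin 3) ℝ

/-- Polynomials on phase space, in the coordinates `(x, y, z, v_∥, μ)`. -/
abbrev Poly5 : Type := MvPolynomial (Fin 5) ℝ

/-- A configuration-space polynomial viewed on phase space. -/
def emb : Poly3 →ₐ[ℝ] Poly5 := MvPolynomial.rename (Fin.castAdd 2)

/-- Piecewise polynomials on configuration space. -/
abbrev Mesh.CFun (M : Mesh S) : Type := M.CCell → Poly3

/-- Piecewise polynomials on the phase space of species `s`. -/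
abbrev Mesh.PFun (M : Mesh S) (s : S) : Type := M.CCell → M.VCell s → Poly5

/-- Continuity of a piecewise polynomial on configuration space across the interfaces (including
the periodic ones) orthogonal to direction `d`. -/
def Mesh.ContAcross (M : Mesh S) (d : Fin 3) (g : M.CFun) : Prop :=
  ∀ (c : M.CCell) (i : Fin (M.grid d).n), (M.grid d).Next (M.periodic d) (c d) i →
    ∀ y ∈ M.cface c d,
      MvPolynomial.eval (atFace d ((M.grid d).edge (c d) Side.hi) y) (g c) =
        MvPolynomial.eval (atFace d ((M.grid d).edge i Side.lo) y) (g (Function.update c d i))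

/-- The space `V_h` of piecewise polynomials taken from `P` on each phase-space cell. -/
def Mesh.Vh (M : Mesh S) (P : Submodule ℝ Poly5) (s : S) : Submodule ℝ (M.PFun s) where
  carrier := {g | ∀ c k, g c k ∈ P}
  add_mem' := fun ha hb c k => P.add_mem (ha c k) (hb c k)
  zero_mem' := fun _ _ => P.zero_mem
  smul_mem' := fun r _ ha c k => P.smul_mem r (ha c k)

/-- The subspace of `V_h` of functions that are continuous across all cell interfaces: those
orthogonal to `x`, `y`, `z` (including the periodic ones), to `v_∥` and to `μ`. -/
def Mesh.VhCont (M : Mesh S) (P : Submodule ℝ Poly5) (s : S) : Submodule ℝ (M.PFun s) where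
  carrier := {g | g ∈ M.Vh P s ∧
    (∀ (d : Fin 3) (c : M.CCell) (i : Fin (M.grid d).n),
      (M.grid d).Next (M.periodic d) (c d) i → ∀ k : M.VCell s,
      ∀ y ∈ M.cface c d, ∀ w ∈ M.vbox k,
        MvPolynomial.eval (pt (atFace d ((M.grid d).edge (c d) Side.hi) y) w) (g c k) =
          MvPolynomial.eval (pt (atFace d ((M.grid d).edge i Side.lo) y) w)
            (g (Function.update c d i) k)) ∧
    (∀ (c : M.CCell) (k : M.VCell s) (i : Fin (M.vGrid s).n), (M.vGrid s).Next False k.1 i →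
      ∀ R ∈ M.cbox c, ∀ mu ∈ M.muBox k,
        MvPolynomial.eval (pt R ((M.vGrid s).edge k.1 Side.hi, mu)) (g c k) =
          MvPolynomial.eval (pt R ((M.vGrid s).edge i Side.lo, mu)) (g c (i, k.2))) ∧
    (∀ (c : M.CCell) (k : M.VCell s) (i : Fin (M.muGrid s).n), (M.muGrid s).Next False k.2 i →
      ∀ R ∈ M.cbox c, ∀ v ∈ M.vparBox k,
        MvPolynomial.eval (pt R (v, (M.muGrid s).edge k.2 Side.hi)) (g c k) =
          MvPolynomial.eval (pt R (v, (M.muGrid s).edge i Side.lo)) (g c (k.1, i)))}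
  add_mem' := by
    rintro a b ⟨h1, h2, h3, h4⟩ ⟨g1, g2, g3, g4⟩
    refine ⟨Submodule.add_mem _ h1 g1, ?_, ?_, ?_⟩
    · intro d c i hi k y hy w hw
      simp [h2 d c i hi k y hy w hw, g2 d c i hi k y hy w hw]
    · intro c k i hi R hR mu hmu
      simp [h3 c k i hi R hR mu hmu, g3 c k i hi R hR mu hmu]
    · intro c k i hi R hR v hv
      simp [h4 c k i hi R hR v hv, g4 c k i hi R hR v hv]
  zero_mem' := by
    refine ⟨Submodule.zero_mem _, ?_, ?_, ?_⟩ <;> intros <;> simp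
  smul_mem' := by
    rintro r a ⟨h1, h2, h3, h4⟩
    refine ⟨Submodule.smul_mem _ r h1, ?_, ?_, ?_⟩
    · intro d c i hi k y hy w hw
      simp [h2 d c i hi k y hy w hw, MvPolynomial.smul_eval]
    · intro c k i hi R hR mu hmu
      simp [h3 c k i hi R hR mu hmu, MvPolynomial.smul_eval]
    · intro c k i hi R hR v hv
      simp [h4 c k i hi R hR v hv, MvPolynomial.smul_eval]

/-- The space `X_h`: restriction of `V_h` to configuration space, i.e. the piecewise polynomials in
`x, y, z` which belong to `P` on each cell. -/
def Mesh.Xh (M : Mesh S) (P : Submodule ℝ Poly5) : Submodule ℝ M.CFun where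
  carrier := {g | ∀ c, emb (g c) ∈ P}
  add_mem' := fun ha hb c => by
    simpa using P.add_mem (ha c) (hb c)
  zero_mem' := fun c => by simp
  smul_mem' := fun r _ ha c => by
    simpa using P.smul_mem r (ha c)

/-- The subspace of `X_h` of functions continuous in the directions in `D`. -/
def Mesh.XhCont (M : Mesh S) (P : Submodule ℝ Poly5) (D : Set (Fin 3)) :
    Submodule ℝ M.CFun where
  carrier := {g | g ∈ M.Xh P ∧ ∀ d ∈ D, M.ContAcross d g}
  add_mem' := by
    rintro a b ⟨h1, h2⟩ ⟨g1, g2⟩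
    refine ⟨Submodule.add_mem _ h1 g1, fun d hd c i hi y hy => ?_⟩
    simp [h2 d hd c i hi y hy, g2 d hd c i hi y hy]
  zero_mem' := ⟨Submodule.zero_mem _, fun d hd c i hi y hy => by simp⟩
  smul_mem' := by
    rintro r a ⟨h1, h2⟩
    refine ⟨Submodule.smul_mem _ r h1, fun d hd c i hi y hy => ?_⟩
    simp [h2 d hd c i hi y hy, MvPolynomial.smul_eval]

/-- The subspace of `X_h` with continuity in the parallel direction `z` only. -/
def Mesh.XhPar (M : Mesh S) (P : Submodule ℝ Poly5) : Submodule ℝ M.CFun := M.XhCont P {2}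

/-- The space of the perpendicular finite-element solves: functions of `X_h` that are continuous in
`x` and `y`, but not necessarily in `z`, and that vanish on those non-periodic walls (orthogonal to
`x` or `y`) on which the homogeneous Dirichlet condition is imposed, as recorded by `dir`. -/
def Mesh.XhPerp (M : Mesh S) (P : Submodule ℝ Poly5) (dir : Fin 3 → Side → Prop) :
    Submodule ℝ M.CFun where
  carrier := {g | g ∈ M.XhCont P {0, 1} ∧
    ∀ d ∈ ({0, 1} : Set (Fin 3)), ¬ M.periodic d → ∀ e : Side, dir d e →
      ∀ c : M.CCell, (M.grid d).edge (c d) e = (M.grid d).wall e →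
        ∀ y ∈ M.cface c d, MvPolynomial.eval (atFace d ((M.grid d).wall e) y) (g c) = 0}
  add_mem' := by
    rintro a b ⟨h1, h2⟩ ⟨g1, g2⟩
    refine ⟨Submodule.add_mem _ h1 g1, fun d hd hp e he c hc y hy => ?_⟩
    simp [h2 d hd hp e he c hc y hy, g2 d hd hp e he c hc y hy]
  zero_mem' := ⟨Submodule.zero_mem _, fun d hd hp e he c hc y hy => by simp⟩
  smul_mem' := by
    rintro r a ⟨h1, h2⟩
    refine ⟨Submodule.smul_mem _ r h1, fun d hd hp e he c hc y hy => ?_⟩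
    simp [h2 d hd hp e he c hc y hy, MvPolynomial.smul_eval]

/-- `∫_{T^R} dR F`, for a function `F` given cell by cell. -/
def Mesh.cInt (M : Mesh S) (F : M.CCell → (Fin 3 → ℝ) → ℝ) : ℝ :=
  ∑ c : M.CCell, ∫ R in M.cbox c, F c R

/-! ### Smoothing in the parallel direction -/

/-- The one-dimensional finite-element smoothing in `z`: `Pz g` is continuous in `z` and has the
same moments as `g` against all `z`-continuous test functions on each column of cells that is
global in `z` and a single cell in `x` and `y`. -/
def Mesh.IsFEMSmoothing (M : Mesh S) (P : Submodule ℝ Poly5) (Pz : M.CFun →ₗ[ℝ] M.CFun) : Prop :=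
  ∀ g : M.CFun, Pz g ∈ M.XhPar P ∧ ∀ c₀ : M.CCell, ∀ χ ∈ M.XhPar P,
    ∑ i : Fin (M.grid 2).n, (∫ R in M.cbox (Function.update c₀ 2 i),
        MvPolynomial.eval R (χ (Function.update c₀ 2 i)) *
          MvPolynomial.eval R (Pz g (Function.update c₀ 2 i))) =
      ∑ i : Fin (M.grid 2).n, (∫ R in M.cbox (Function.update c₀ 2 i),
        MvPolynomial.eval R (χ (Function.update c₀ 2 i)) *
          MvPolynomial.eval R (g (Function.update c₀ 2 i)))

/-- The finite-element smoothing is a projection onto the `z`-continuous subspace of `X_h`. -/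
theorem Mesh.IsFEMSmoothing.isProj (M : Mesh S) (P : Submodule ℝ Poly5) (Pz : M.CFun →ₗ[ℝ] M.CFun)
    (h : M.IsFEMSmoothing P Pz) : LinearMap.IsProj (M.XhPar P) Pz := by
  refine ⟨fun g => (h g).1, fun g hg => ?_⟩
  have he : Pz g - g ∈ M.XhPar P := Submodule.sub_mem _ (h g).1 hg
  have hcont : ∀ a : Poly3, Continuous fun R : Fin 3 → ℝ => MvPolynomial.eval R a :=
    fun a => MvPolynomial.continuous_eval a
  funext c
  have hint : ∀ (a b : Poly3) (c' : M.CCell), MeasureTheory.IntegrableOn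
      (fun R : Fin 3 → ℝ => MvPolynomial.eval R a * MvPolynomial.eval R b) (M.cbox c') :=
    fun a b c' => (((hcont a).mul (hcont b)).continuousOn).integrableOn_compact isCompact_Icc
  have hsum := (h g).2 c (Pz g - g) he
  rw [← sub_eq_zero, ← Finset.sum_sub_distrib] at hsum
  have hsq : ∀ i : Fin (M.grid 2).n,
      (∫ R in M.cbox (Function.update c 2 i),
        MvPolynomial.eval R ((Pz g - g) (Function.update c 2 i)) *
          MvPolynomial.eval R (Pz g (Function.update c 2 i))) -
      (∫ R in M.cbox (Function.update c 2 i),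
        MvPolynomial.eval R ((Pz g - g) (Function.update c 2 i)) *
          MvPolynomial.eval R (g (Function.update c 2 i))) =
      ∫ R in M.cbox (Function.update c 2 i),
        (MvPolynomial.eval R ((Pz g - g) (Function.update c 2 i))) ^ 2 := by
    intro i
    rw [← MeasureTheory.integral_sub (hint _ _ _) (hint _ _ _)]
    congr 1
    funext R
    simp only [Pi.sub_apply, map_sub]
    ring
  rw [Finset.sum_congr rfl (fun i _ => hsq i), Finset.sum_eq_zero_iff_of_nonneg
    (fun i _ => MeasureTheory.integral_nonneg fun R => sq_nonneg _)] at hsum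
  have h0 := hsum (c 2) (Finset.mem_univ _)
  rw [Function.update_eq_self] at h0
  have hint2 : MeasureTheory.IntegrableOn
      (fun R : Fin 3 → ℝ => (MvPolynomial.eval R ((Pz g - g) c)) ^ 2) (M.cbox c) :=
    ((hcont _).pow 2).continuousOn.integrableOn_compact isCompact_Icc
  rw [MeasureTheory.setIntegral_eq_zero_iff_of_nonneg_ae
    (Filter.Eventually.of_forall fun R => sq_nonneg _) hint2] at h0
  have h1 : (fun R : Fin 3 → ℝ => (MvPolynomial.eval R ((Pz g - g) c)) ^ 2) =ᵐ[
      MeasureTheory.volume.restrict (Set.univ.pi fun d =>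
        Set.Ioo ((M.grid d).edge (c d) Side.lo) ((M.grid d).edge (c d) Side.hi))] 0 := by
    refine Filter.EventuallyEq.filter_mono h0
      (MeasureTheory.ae_mono (MeasureTheory.Measure.restrict_mono ?_ le_rfl))
    intro R hR
    exact ⟨fun d => (hR d trivial).1.le, fun d => (hR d trivial).2.le⟩
  have h2 := MeasureTheory.Measure.eqOn_open_of_ae_eq h1
    (isOpen_set_pi Set.finite_univ fun d _ => isOpen_Ioo)
    ((hcont _).pow 2).continuousOn continuousOn_const
  have h3 : (Pz g - g) c = 0 := by
    refine MvPolynomial.funext_set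
      (fun d => Set.Ioo ((M.grid d).edge (c d) Side.lo) ((M.grid d).edge (c d) Side.hi))
      (fun d => Set.Ioo_infinite ((M.grid d).node_strictMono (Fin.castSucc_lt_succ))) ?_
    intro R hR
    have := h2 hR
    simpa using this
  exact sub_eq_zero.mp h3

/-- `PzStar` is the adjoint of `Pz : X_h → X_h`: for each function `F` integrable on the cells,
`PzStar F ∈ X_h` and `∫ F Pz[g] = ∫ PzStar[F] g` for all `g ∈ X_h`. -/
def Mesh.IsAdjointSmoothing (M : Mesh S) (P : Submodule ℝ Poly5) (Pz : M.CFun →ₗ[ℝ] M.CFun)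
    (PzStar : (M.CCell → (Fin 3 → ℝ) → ℝ) → M.CFun) : Prop :=
  ∀ F : M.CCell → (Fin 3 → ℝ) → ℝ,
    (∀ c, MeasureTheory.IntegrableOn (F c) (M.cbox c)) →
      PzStar F ∈ M.Xh P ∧ ∀ g ∈ M.Xh P,
        M.cInt (fun c R => F c R * MvPolynomial.eval R (Pz g c)) =
          M.cInt (fun c R => MvPolynomial.eval R (PzStar F c) * MvPolynomial.eval R (g c))

/-! ### Physical and numerical data -/

/-- Species parameters and equilibrium. The coordinates are field aligned, `z` being the direction
of the unit vector `b` along the equilibrium field `B b`, with `dR = dx dy dz`. The vector field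
`curlb` is `∇ × b` (nonzero in general, as the field lines may be curved), whose parallel component
is neglected. `n0 s` is the time-independent density used in the linearized polarization. -/
structure Plasma (M : Mesh S) where
  m : S → ℝ
  q : S → ℝ
  mu0 : ℝ
  B : (Fin 3 → ℝ) → ℝ
  curlb : (Fin 3 → ℝ) → Fin 3 → ℝ
  n0 : S → (Fin 3 → ℝ) → ℝ
  m_pos : ∀ s, 0 < m s
  q_ne : ∀ s, q s ≠ 0
  mu0_pos : 0 < mu0
  B_pos : ∀ R ∈ M.domain, 0 < B R
  B_cont : ContinuousOn B M.domain
  curlb_cont : ContinuousOn curlb M.domain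
  n0_cont : ∀ s, ContinuousOn (n0 s) M.domain
  curlb_par : ∀ R, curlb R 2 = 0
  B_periodic : ∀ d, M.periodic d → ∀ y, atFace d ((M.grid d).wall Side.hi) y ∈ M.domain →
    B (atFace d ((M.grid d).wall Side.hi) y) = B (atFace d ((M.grid d).wall Side.lo) y)
  curlb_periodic : ∀ d, M.periodic d → ∀ y, atFace d ((M.grid d).wall Side.hi) y ∈ M.domain →
    curlb (atFace d ((M.grid d).wall Side.hi) y) = curlb (atFace d ((M.grid d).wall Side.lo) y)

/-- The unit vector along the equilibrium magnetic field. -/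
def bvec : Fin 3 → ℝ := ![0, 0, 1]

/-- Effective magnetic field `B* = B b + (m v_∥ / q) ∇ × b + ∇A_∥ × b`; the argument `gA` is the
gradient of `A_∥`. -/
def Plasma.Bstar {M : Mesh S} (E : Plasma M) (s : S) (gA : Fin 3 → ℝ) (R : Fin 3 → ℝ) (v : ℝ) :
    Fin 3 → ℝ :=
  E.B R • bvec + (E.m s * v / E.q s) • E.curlb R + crossProduct gA bvec

/-- The parallel component of `B*`, which is the Jacobian `J` of the gyrocentre coordinates, is
`B`. -/
theorem Plasma.bvec_dot_Bstar {M : Mesh S} (E : Plasma M) (s : S) (gA R : Fin 3 → ℝ) (v : ℝ) :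
    bvec ⬝ᵥ E.Bstar s gA R v = E.B R := by
  rw [dotProduct, Fin.sum_univ_three, Plasma.Bstar]
  simp only [Pi.add_apply, Pi.smul_apply, E.curlb_par, bvec]
  simp [cross_apply]

/-- The gyrokinetic Poisson bracket `{F, G}` at a point, in terms of the gradients `gF, gG` and the
`v_∥`-derivatives `dF, dG` of `F` and `G` (with `B*_∥ = B`). -/
def Plasma.bracket {M : Mesh S} (E : Plasma M) (s : S) (gA : Fin 3 → ℝ) (R : Fin 3 → ℝ) (v : ℝ)
    (gF : Fin 3 → ℝ) (dF : ℝ) (gG : Fin 3 → ℝ) (dG : ℝ) : ℝ :=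
  (1 / (E.m s * E.B R)) * (E.Bstar s gA R v ⬝ᵥ (dG • gF - dF • gG)) -
    (1 / (E.q s * E.B R)) * (crossProduct bvec gF ⬝ᵥ gG)

/-- `ε_⊥ = ∑_s m_s n_{0s} / B²`. -/
def Plasma.epsPerp [Fintype S] {M : Mesh S} (E : Plasma M) (R : Fin 3 → ℝ) : ℝ :=
  ∑ s, E.m s * E.n0 s R / E.B R ^ 2

/-- `∫_{K^v} dw F` with `dw = (2π / m_s) dv_∥ dμ`. -/
def Plasma.wInt {M : Mesh S} (E : Plasma M) {s : S} (k : M.VCell s) (F : ℝ × ℝ → ℝ) : ℝ :=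
  ∫ w in M.vbox k, (2 * Real.pi / E.m s) * F w

/-- `∫_K dR dw F` over a phase-space cell. -/
def Plasma.pInt {M : Mesh S} (E : Plasma M) {s : S} (c : M.CCell) (k : M.VCell s)
    (F : (Fin 3 → ℝ) → ℝ × ℝ → ℝ) : ℝ :=
  ∫ R in M.cbox c, E.wInt k (F R)

/-- Values of a numerical flux (the quantity `J f` with a hat) on the faces of the cells: `R c k d e y w`
is its value on the face of the cell `(c, k)` orthogonal to the configuration-space direction `d`,
and `V c k e R mu` its value on the face orthogonal to `v_∥`. It is arbitrary but for two
properties: it takes a single value at each interface, and it vanishes on the non-periodic part of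
the boundary, where the distribution function vanishes. -/
structure NumericalFlux (M : Mesh S) (s : S) where
  R : M.CCell → M.VCell s → Fin 3 → Side → (Fin 2 → ℝ) → ℝ × ℝ → ℝ
  V : M.CCell → M.VCell s → Side → (Fin 3 → ℝ) → ℝ → ℝ
  R_single : ∀ (c : M.CCell) (k : M.VCell s) (d : Fin 3) (i : Fin (M.grid d).n),
    (M.grid d).Next (M.periodic d) (c d) i → ∀ y w,
      R c k d Side.hi y w = R (Function.update c d i) k d Side.lo y w
  V_single : ∀ (c : M.CCell) (k : M.VCell s) (i : Fin (M.vGrid s).n),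
    (M.vGrid s).Next False k.1 i → ∀ x mu, V c k Side.hi x mu = V c (i, k.2) Side.lo x mu
  R_boundary : ∀ (c : M.CCell) (k : M.VCell s) (d : Fin 3), ¬ M.periodic d → ∀ e : Side,
    (M.grid d).edge (c d) e = (M.grid d).wall e → ∀ y w, R c k d e y w = 0
  V_boundary : ∀ (c : M.CCell) (k : M.VCell s) (e : Side),
    (M.vGrid s).edge k.1 e = (M.vGrid s).wall e → ∀ x mu, V c k e x mu = 0

/-- Data of the discretization: the finite-dimensional space `P` of polynomials used on each cell,
the discrete field strength `Bh` entering the Hamiltonian, the walls with a homogeneous Dirichlet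
condition for the potentials (the other non-periodic walls carry the natural condition), the
projection onto the continuous subspace of `V_h` which is applied to `v_∥²`, and the smoothing
projection `Pz` onto the `z`-continuous functions, with its adjoint `PzStar`. -/
structure Discretization (M : Mesh S) where
  P : Submodule ℝ Poly5
  P_finite : FiniteDimensional ℝ P
  Bh : M.CFun
  dirPhi : Fin 3 → Side → Prop
  dirA : Fin 3 → Side → Prop
  velProj : (s : S) → M.PFun s →ₗ[ℝ] M.PFun s
  velProj_isProj : ∀ s, LinearMap.IsProj (M.VhCont P s) (velProj s)
  Pz : M.CFun →ₗ[ℝ] M.CFun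
  Pz_isProj : LinearMap.IsProj (M.XhPar P) Pz
  PzStar : (M.CCell → (Fin 3 → ℝ) → ℝ) → M.CFun
  PzStar_adjoint : M.IsAdjointSmoothing P Pz PzStar

/-- The time-dependent unknowns: the distribution functions `f`, the potentials `phi` (before
smoothing) and `A` (parallel vector potential), their time derivatives, and the numerical fluxes. -/
structure Unknowns (M : Mesh S) where
  f : (s : S) → ℝ → M.PFun s
  f' : (s : S) → ℝ → M.PFun s
  phi : ℝ → M.CFun
  phi' : ℝ → M.CFun
  A : ℝ → M.CFun
  A' : ℝ → M.CFun
  flux : (s : S) → ℝ → NumericalFlux M s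

section Scheme

variable {M : Mesh S} (E : Plasma M) (D : Discretization M) (U : Unknowns M)

/-- Gradient in `R` of a configuration-space polynomial. -/
def grad3 (g : Poly3) (R : Fin 3 → ℝ) : Fin 3 → ℝ :=
  fun d => MvPolynomial.eval R (MvPolynomial.pderiv d g)

/-- Gradient in `R` of a phase-space polynomial. -/
def grad5 (g : Poly5) (R : Fin 3 → ℝ) (w : ℝ × ℝ) : Fin 3 → ℝ :=
  fun d => MvPolynomial.eval (pt R w) (MvPolynomial.pderiv (Fin.castAdd 2 d) g)

/-- The derivative in `v_∥` of a phase-space polynomial. -/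
def dvpar (g : Poly5) (R : Fin 3 → ℝ) (w : ℝ × ℝ) : ℝ :=
  MvPolynomial.eval (pt R w) (MvPolynomial.pderiv 3 g)

/-- `∇_⊥ g · ∇_⊥ h`. -/
def perpDot (g h : Poly3) (R : Fin 3 → ℝ) : ℝ :=
  grad3 g R 0 * grad3 h R 0 + grad3 g R 1 * grad3 h R 1

/-- The discrete Hamiltonian `H_h = m (v_∥²)_h / 2 + μ B_h + q P_z[φ_h]`. -/
def Ham (s : S) (t : ℝ) : M.PFun s := fun c k =>
  MvPolynomial.C (E.m s / 2) * D.velProj s (fun _ _ => MvPolynomial.X 3 ^ 2) c k +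
    MvPolynomial.X 4 * emb (D.Bh c) + MvPolynomial.C (E.q s) * emb (D.Pz (U.phi t) c)

/-- The discrete characteristics `dR_d/dt = {R_d, H_h}`, evaluated from inside the cell. -/
def Rdot (s : S) (t : ℝ) (c : M.CCell) (k : M.VCell s) (d : Fin 3) (R : Fin 3 → ℝ)
    (w : ℝ × ℝ) : ℝ :=
  E.bracket s (grad3 (U.A t c) R) R w.1 (Pi.single d 1) 0
    (grad5 (Ham E D U s t c k) R w) (dvpar (Ham E D U s t c k) R w)

/-- The discrete Hamiltonian acceleration `{v_∥, H_h}`, evaluated from inside the cell. -/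
def vdotH (s : S) (t : ℝ) (c : M.CCell) (k : M.VCell s) (R : Fin 3 → ℝ) (w : ℝ × ℝ) : ℝ :=
  E.bracket s (grad3 (U.A t c) R) R w.1 0 1
    (grad5 (Ham E D U s t c k) R w) (dvpar (Ham E D U s t c k) R w)

/-- The full discrete acceleration `{v_∥, H_h} - (q/m) ∂A_∥/∂t`. -/
def vdot (s : S) (t : ℝ) (c : M.CCell) (k : M.VCell s) (R : Fin 3 → ℝ) (w : ℝ × ℝ) : ℝ :=
  vdotH E D U s t c k R w - E.q s / E.m s * MvPolynomial.eval R (U.A' t c)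

/-- Surface integral over one face orthogonal to the configuration-space direction `d`, with the
normal in the positive direction; `psi` is evaluated from inside the cell. -/
def surfR (s : S) (t : ℝ) (c : M.CCell) (k : M.VCell s) (psi : Poly5) (d : Fin 3) (e : Side) : ℝ :=
  ∫ y in M.cface c d, E.wInt k (fun w =>
    Rdot E D U s t c k d (atFace d ((M.grid d).edge (c d) e) y) w *
      MvPolynomial.eval (pt (atFace d ((M.grid d).edge (c d) e) y) w) psi *
        (U.flux s t).R c k d e y w)

/-- Surface integral over one face orthogonal to `v_∥`, with the normal in the positive
direction. -/
def surfV (s : S) (t : ℝ) (c : M.CCell) (k : M.VCell s) (psi : Poly5) (e : Side) : ℝ :=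
  ∫ R in M.cbox c, ∫ mu in M.muBox k, (2 * Real.pi / E.m s) *
    (vdot E D U s t c k R ((M.vGrid s).edge k.1 e, mu) *
      MvPolynomial.eval (pt R ((M.vGrid s).edge k.1 e, mu)) psi * (U.flux s t).V c k e R mu)

/-- The discontinuous Galerkin weak form of the collisionless, source-free gyrokinetic equation in
the cell `(c, k)`, for the test function `psi`. -/
def WeakGK (s : S) (t : ℝ) (c : M.CCell) (k : M.VCell s) (psi : Poly5) : Prop :=
  E.pInt c k (fun R w => MvPolynomial.eval (pt R w) psi *
      (E.B R * MvPolynomial.eval (pt R w) (U.f' s t c k))) +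
    ∑ d : Fin 3, (surfR E D U s t c k psi d Side.hi - surfR E D U s t c k psi d Side.lo) +
    (surfV E D U s t c k psi Side.hi - surfV E D U s t c k psi Side.lo) -
    E.pInt c k (fun R w => E.B R * MvPolynomial.eval (pt R w) (U.f s t c k) *
      ∑ d : Fin 3, Rdot E D U s t c k d R w * grad5 psi R w d) -
    E.pInt c k (fun R w => E.B R * MvPolynomial.eval (pt R w) (U.f s t c k) *
      vdot E D U s t c k R w * dvpar psi R w) = 0

variable [Fintype S]

/-- Guiding-centre charge density `∑_s q_s ∫ dw J f_s`. -/
def chargeDensity (t : ℝ) (c : M.CCell) (R : Fin 3 → ℝ) : ℝ :=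
  ∑ s, E.q s * ∑ k : M.VCell s,
    E.wInt k (fun w => E.B R * MvPolynomial.eval (pt R w) (U.f s t c k))

/-- Parallel current density `∑_s (q_s/m_s) ∫ dw J (∂H_h/∂v_∥) f_s`. -/
def Jpar (t : ℝ) (c : M.CCell) (R : Fin 3 → ℝ) : ℝ :=
  ∑ s, E.q s / E.m s * ∑ k : M.VCell s,
    E.wInt k (fun w => E.B R * dvpar (Ham E D U s t c k) R w *
      MvPolynomial.eval (pt R w) (U.f s t c k))

/-- `U` solves the semi-discrete scheme on the time interval `I`. -/
structure IsSolution (I : Set ℝ) : Prop where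
  f_mem : ∀ s, ∀ t ∈ I, U.f s t ∈ M.Vh D.P s
  phi_mem : ∀ t ∈ I, U.phi t ∈ M.XhPerp D.P D.dirPhi
  A_mem : ∀ t ∈ I, U.A t ∈ M.XhPerp D.P D.dirA
  -- `f'`, `phi'`, `A'` are the time derivatives (coefficient by coefficient in each cell)
  f_deriv : ∀ s, ∀ t ∈ I, ∀ c k a,
    HasDerivWithinAt (fun τ => (U.f s τ c k).coeff a) ((U.f' s t c k).coeff a) I t
  phi_deriv : ∀ t ∈ I, ∀ c a,
    HasDerivWithinAt (fun τ => (U.phi τ c).coeff a) ((U.phi' t c).coeff a) I t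
  A_deriv : ∀ t ∈ I, ∀ c a,
    HasDerivWithinAt (fun τ => (U.A τ c).coeff a) ((U.A' t c).coeff a) I t
  gyrokinetic : ∀ s, ∀ t ∈ I, ∀ c k, ∀ psi ∈ D.P, WeakGK E D U s t c k psi
  poisson : ∀ t ∈ I, ∀ xi ∈ M.XhPerp D.P D.dirPhi,
    M.cInt (fun c R => E.epsPerp R * perpDot (U.phi t c) (xi c) R) =
      M.cInt (fun c R => MvPolynomial.eval R (xi c) *
        MvPolynomial.eval R (D.PzStar (chargeDensity E U t) c))
  ampere : ∀ t ∈ I, ∀ vphi ∈ M.XhPerp D.P D.dirA,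
    M.cInt (fun c R => perpDot (U.A t c) (vphi c) R) =
      E.mu0 * M.cInt (fun c R => MvPolynomial.eval R (vphi c) * Jpar E D U t c R)

/-- Discrete particle energy `∑_s ∫ dR dw J f_s H_s`. -/
def energyH (t : ℝ) : ℝ :=
  ∑ s, ∑ c : M.CCell, ∑ k : M.VCell s, E.pInt c k (fun R w =>
    E.B R * MvPolynomial.eval (pt R w) (U.f s t c k) *
      MvPolynomial.eval (pt R w) (Ham E D U s t c k))

/-- Discrete electrostatic field energy `∫ dR (ε_⊥/2) |∇_⊥ φ|²`. -/
def energyE (t : ℝ) : ℝ :=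
  M.cInt (fun c R => E.epsPerp R / 2 * perpDot (U.phi t c) (U.phi t c) R)

/-- Discrete magnetic field energy `∫ dR |∇_⊥ A_∥|² / (2 μ_0)`. -/
def energyB (t : ℝ) : ℝ :=
  M.cInt (fun c R => 1 / (2 * E.mu0) * perpDot (U.A t c) (U.A t c) R)

/-- Discrete total energy. -/
def energy (t : ℝ) : ℝ := energyH E D U t - energyE E U t + energyB E U t

end Scheme

end

end EMGK

/-!
The time derivative of `W_H - W_E + W_B` is
`∑ ∫ J H ∂_t f + ∑ q ∫ J f P_z[∂_t φ] - ∫ ε_⊥ ∇_⊥φ · ∇_⊥∂_tφ + (1/μ_0) ∫ ∇_⊥A · ∇_⊥∂_tA`.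

* The second and third terms cancel: `∂_t φ` lies in the linear space in which `φ` is sought, so it
  is an admissible test function in the Poisson equation, and the adjoint of the smoothing moves
  `P_z` onto the charge density.
* In the first term, the Hamiltonian is an admissible test function on each cell. By `{H, H} = 0`
  the volume terms reduce to the work of `-(q/m) ∂_t A` (`volume_terms_eq`). The surface terms
  cancel in pairs (`sum_surfR_eq_zero`, `sum_surfV_eq_zero`): the flux is single-valued by
  hypothesis, `H` is continuous, and the normal component of the characteristics is continuous
  because it only involves derivatives of `H` and of `A` tangential to the face; these are
  determined by the traces, which agree (`pderiv_eq_of_trace_eq`). This is why continuity of `A` in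
  `x` and `y` is enough: the `z`-component of `B*` does not involve `A`.
* What is left of the first term, `-∫ J_∥ ∂_t A`, cancels with the last term by Ampère's law tested
  with `∂_t A`.

Time derivatives of the unknowns are given coefficient by coefficient. As the unknowns stay in
finite-dimensional spaces, they can be differentiated under any linear functional
(`HasWeakDeriv.of_coeff`) and inside any bilinear form (`HasWeakDeriv.bilin`), and their
derivatives stay in the same spaces (`HasWeakDeriv.mem`).
-/

namespace EMGK

/-! ### Families differentiable in a finite-dimensional space -/

/-- `f` has derivative `f'` at `t` within `I` after composition with each linear functional. This is
differentiability in a vector space that carries no topology, such as a space of polynomials. -/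
def HasWeakDeriv {V : Type*} [AddCommGroup V] [Module ℝ V] (f : ℝ → V) (f' : V) (I : Set ℝ)
    (t : ℝ) : Prop :=
  ∀ L : V →ₗ[ℝ] ℝ, HasDerivWithinAt (fun τ => L (f τ)) (L f') I t

namespace HasWeakDeriv

variable {V W : Type*} [AddCommGroup V] [Module ℝ V] [AddCommGroup W] [Module ℝ W]
  {f : ℝ → V} {f' : V} {g : ℝ → W} {g' : W} {I : Set ℝ} {t : ℝ}

theorem map (h : HasWeakDeriv f f' I t) (T : V →ₗ[ℝ] W) :
    HasWeakDeriv (fun τ => T (f τ)) (T f') I t :=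
  fun L => h (L ∘ₗ T)

theorem const_add (h : HasWeakDeriv f f' I t) (v : V) :
    HasWeakDeriv (fun τ => v + f τ) f' I t := by
  intro L
  simpa using (h L).const_add (L v)

/-- The derivative of a family in a linear subspace lies in that subspace. -/
theorem mem (h : HasWeakDeriv f f' I t) (hacc : AccPt t (Filter.principal I)) (ht : t ∈ I)
    (F : Submodule ℝ V) (hF : ∀ τ ∈ I, f τ ∈ F) : f' ∈ F := by
  rw [← Submodule.Quotient.mk_eq_zero, ← Module.forall_dual_apply_eq_zero_iff ℝ]
  intro L
  have h1 := h (L ∘ₗ F.mkQ)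
  have h0 : HasDerivWithinAt (fun τ => (L ∘ₗ F.mkQ) (f τ)) 0 I t := by
    refine (hasDerivWithinAt_const t I (0 : ℝ)).congr ?_ ?_
    · intro τ hτ
      simp [(Submodule.Quotient.mk_eq_zero F).2 (hF τ hτ)]
    · simp [(Submodule.Quotient.mk_eq_zero F).2 (hF t ht)]
  exact (uniqueDiffWithinAt_iff_accPt.2 hacc).eq_deriv I h1 h0

/-- Leibniz rule for a bilinear form, one of whose arguments stays in a finite-dimensional
subspace. -/
theorem bilin (hf : HasWeakDeriv f f' I t) (hg : HasWeakDeriv g g' I t)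
    (hacc : AccPt t (Filter.principal I)) (ht : t ∈ I) (F : Submodule ℝ V)
    [FiniteDimensional ℝ F] (hF : ∀ τ ∈ I, f τ ∈ F) (β : V →ₗ[ℝ] W →ₗ[ℝ] ℝ) :
    HasDerivWithinAt (fun τ => β (f τ) (g τ)) (β f' (g t) + β (f t) g') I t := by
  have hf' : f' ∈ F := hf.mem hacc ht F hF
  let b := Module.finBasis ℝ F
  choose L hL using fun i => LinearMap.exists_extend (b.coord i)
  have hexp : ∀ v ∈ F, ∀ w, β v w = ∑ i, L i v * β (b i) w := by
    intro v hv w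
    have h1 : v = ∑ i, L i v • (b i : V) := by
      have h2 := congrArg Subtype.val (b.sum_repr ⟨v, hv⟩)
      have h3 : ∀ i, L i v = b.repr ⟨v, hv⟩ i := fun i =>
        LinearMap.congr_fun (hL i) ⟨v, hv⟩
      simp only [h3]
      simp only [AddSubmonoidClass.coe_finsetSum, Submodule.coe_smul] at h2
      exact h2.symm
    conv_lhs => rw [h1]
    simp [LinearMap.sum_apply]
  have hd : HasDerivWithinAt (fun τ => ∑ i, L i (f τ) * β (b i) (g τ))
      (∑ i, (L i f' * β (b i) (g t) + L i (f t) * β (b i) g')) I t :=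
    HasDerivWithinAt.fun_sum fun i _ => (hf (L i)).mul (hg (β (b i)))
  have he : β f' (g t) + β (f t) g' =
      ∑ i, (L i f' * β (b i) (g t) + L i (f t) * β (b i) g') := by
    rw [Finset.sum_add_distrib, hexp f' hf', hexp (f t) (hF t ht)]
  rw [he]
  exact hd.congr (fun τ hτ => hexp _ (hF τ hτ) _) (hexp _ (hF t ht) _)

/-- A coefficientwise derivative of polynomials in a finite-dimensional space is a derivative for
each linear functional, as only finitely many monomials occur. -/
theorem of_coeff {σ : Type*} {p : ℝ → MvPolynomial σ ℝ} {p' : MvPolynomial σ ℝ}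
    (hacc : AccPt t (Filter.principal I)) (ht : t ∈ I) (F : Submodule ℝ (MvPolynomial σ ℝ))
    [hfin : FiniteDimensional ℝ F] (hF : ∀ τ ∈ I, p τ ∈ F)
    (h : ∀ a, HasDerivWithinAt (fun τ => (p τ).coeff a) (p'.coeff a) I t) :
    HasWeakDeriv p p' I t := by
  classical
  obtain ⟨B, hB⟩ := Module.Finite.iff_fg.1 hfin
  let T := B.biUnion MvPolynomial.support
  have hT : ∀ q ∈ F, q.support ⊆ T := by
    intro q hq
    have h1 : F ≤ MvPolynomial.restrictSupport ℝ (T : Set (σ →₀ ℕ)) := by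
      rw [← hB, Submodule.span_le]
      intro r hr
      rw [SetLike.mem_coe, MvPolynomial.mem_restrictSupport_iff]
      exact_mod_cast Finset.subset_biUnion_of_mem MvPolynomial.support hr
    exact_mod_cast (MvPolynomial.mem_restrictSupport_iff ℝ).1 (h1 hq)
  have hT' : p'.support ⊆ T := by
    intro a ha
    by_contra haT
    have h0 : HasDerivWithinAt (fun τ => (p τ).coeff a) 0 I t := by
      refine (hasDerivWithinAt_const t I (0 : ℝ)).congr ?_ ?_
      · exact fun τ hτ => MvPolynomial.notMem_support_iff.1 fun hm => haT (hT _ (hF τ hτ) hm)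
      · exact MvPolynomial.notMem_support_iff.1 fun hm => haT (hT _ (hF t ht) hm)
    exact MvPolynomial.mem_support_iff.1 ha
      ((uniqueDiffWithinAt_iff_accPt.2 hacc).eq_deriv I (h a) h0)
  intro L
  have hexp : ∀ q : MvPolynomial σ ℝ, q.support ⊆ T →
      L q = ∑ a ∈ T, q.coeff a * L (MvPolynomial.monomial a 1) := by
    intro q hq
    conv_lhs => rw [q.as_sum, map_sum]
    rw [Finset.sum_subset hq]
    · refine Finset.sum_congr rfl fun a _ => ?_
      rw [← smul_eq_mul, ← map_smul, MvPolynomial.smul_monomial, smul_eq_mul, mul_one]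
    · intro a _ ha
      rw [MvPolynomial.notMem_support_iff.1 ha]
      simp
  rw [hexp p' hT']
  exact (HasDerivWithinAt.fun_sum fun a _ => (h a).mul_const _).congr
    (fun τ hτ => hexp _ (hT _ (hF τ hτ))) (hexp _ (hT _ (hF t ht)))

theorem pi {ι : Type*} [Fintype ι] {p : ℝ → ι → V} {p' : ι → V}
    (h : ∀ i, HasWeakDeriv (fun τ => p τ i) (p' i) I t) : HasWeakDeriv p p' I t := by
  classical
  intro L
  have hexp : ∀ q : ι → V, L q = ∑ i, (L ∘ₗ LinearMap.single ℝ (fun _ => V) i) (q i) := by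
    intro q
    conv_lhs => rw [← Finset.univ_sum_single q, map_sum]
    simp
  simp only [hexp]
  exact HasDerivWithinAt.fun_sum fun i _ => h i _

end HasWeakDeriv

/-! ### Traces of polynomials -/

/-- If the restrictions of `p` to the hyperplane `z i = a` and of `q` to the hyperplane `z i = b`
agree on a product of infinite sets, they agree as polynomials in the other variables, and so do
their tangential derivatives. -/
theorem pderiv_eq_of_trace_eq {σ : Type*} [DecidableEq σ] {p q : MvPolynomial σ ℝ} {i : σ}
    {a b : ℝ} (s : σ → Set ℝ) (hs : ∀ j, (s j).Infinite)
    (h : ∀ z ∈ Set.univ.pi s, MvPolynomial.eval (Function.update z i a) p =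
      MvPolynomial.eval (Function.update z i b) q) {j : σ} (hj : j ≠ i) (z : σ → ℝ) :
    MvPolynomial.eval (Function.update z i a) (MvPolynomial.pderiv j p) =
      MvPolynomial.eval (Function.update z i b) (MvPolynomial.pderiv j q) := by
  -- restriction to the hyperplane, as a substitution
  let ρ : ℝ → MvPolynomial σ ℝ →ₐ[ℝ] MvPolynomial σ ℝ := fun a =>
    MvPolynomial.aeval (Function.update MvPolynomial.X i (MvPolynomial.C a))
  have hρ : ∀ a r z, MvPolynomial.eval z (ρ a r) = MvPolynomial.eval (Function.update z i a) r := by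
    intro a r z
    induction r using MvPolynomial.induction_on with
    | C c => simp [ρ]
    | add r₁ r₂ h₁ h₂ => simp [h₁, h₂]
    | mul_X r k hr =>
      rw [map_mul, map_mul, hr, map_mul]
      by_cases hk : k = i
      · subst hk; simp [ρ]
      · simp [ρ, hk]
  have hder : ∀ a r, MvPolynomial.pderiv j (ρ a r) = ρ a (MvPolynomial.pderiv j r) := by
    intro a r
    induction r using MvPolynomial.induction_on with
    | C c => simp [ρ, MvPolynomial.algebraMap_eq]
    | add r₁ r₂ h₁ h₂ => simp [h₁, h₂]
    | mul_X r k hr =>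
      rw [map_mul, Derivation.leibniz, hr, Derivation.leibniz, map_add]
      by_cases hk : k = i
      · subst hk; simp [ρ, MvPolynomial.pderiv_X_of_ne hj.symm]
      · by_cases hkj : k = j
        · subst hkj; simp [ρ, hk]
        · simp [ρ, hk, MvPolynomial.pderiv_X_of_ne hkj]
  have heq : ρ a p = ρ b q :=
    MvPolynomial.funext_set s hs fun z hz => by rw [hρ, hρ, h z hz]
  rw [← hρ, ← hρ, ← hder, ← hder, heq]

/-! ### Sums over the interfaces of the mesh -/

variable {S : Type*}

theorem Grid.next_or_wall (g : Grid) (per : Prop) (i : Fin g.n) :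
    g.Next per i (finRotate g.n i) ∨
      (¬ per ∧ g.edge i Side.hi = g.wall Side.hi ∧
        g.edge (finRotate g.n i) Side.lo = g.wall Side.lo) := by
  obtain ⟨n, hn, node, hnode⟩ := g
  obtain ⟨n, rfl⟩ : ∃ m, n = m + 1 := ⟨n - 1, by omega⟩
  simp only [Grid.Next, Grid.edge, Grid.wall] at i ⊢
  by_cases hi : i = Fin.last n
  · subst hi
    by_cases hp : per
    · left; right
      simp [hp]
    · right
      simp [hp]
  · left; left
    rw [coe_finRotate_of_ne_last hi]

theorem Grid.Next.edge_eq {g : Grid} {per : Prop} {i j : Fin g.n} (h : g.Next per i j) :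
    g.edge i Side.hi = g.edge j Side.lo ∨
      (per ∧ g.edge i Side.hi = g.wall Side.hi ∧ g.edge j Side.lo = g.wall Side.lo) := by
  rcases h with h | ⟨hp, h1, h2⟩
  · left
    simp only [Grid.edge]
    congr 1
    ext
    simpa using h
  · right
    refine ⟨hp, ?_, ?_⟩
    · simp only [Grid.edge, Grid.wall]
      congr 1
      ext
      simpa using h1
    · simp only [Grid.edge, Grid.wall]
      congr 1
      ext
      simpa using h2

/-- The upper ends of the cells match the lower ends after rotating the grid by one cell; at a
non-periodic wall both contributions vanish. -/
theorem Grid.sum_hi_eq_sum_lo (g : Grid) (per : Prop) (F : Fin g.n → Side → ℝ)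
    (hnext : ∀ i j, g.Next per i j → F i Side.hi = F j Side.lo)
    (hwall : ¬ per → ∀ i e, g.edge i e = g.wall e → F i e = 0) :
    ∑ i, F i Side.hi = ∑ i, F i Side.lo := by
  rw [← Equiv.sum_comp (finRotate g.n) fun i => F i Side.lo]
  refine Finset.sum_congr rfl fun i _ => ?_
  rcases g.next_or_wall per i with h | ⟨hp, h1, h2⟩
  · exact hnext _ _ h
  · rw [hwall hp _ _ h1, hwall hp _ _ h2]

theorem Mesh.sum_hi_eq_sum_lo (M : Mesh S) (d : Fin 3) (F : M.CCell → Side → ℝ)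
    (hnext : ∀ c i, (M.grid d).Next (M.periodic d) (c d) i →
      F c Side.hi = F (Function.update c d i) Side.lo)
    (hwall : ¬ M.periodic d → ∀ c e, (M.grid d).edge (c d) e = (M.grid d).wall e → F c e = 0) :
    ∑ c, F c Side.hi = ∑ c, F c Side.lo := by
  let r := finRotate (M.grid d).n
  let rot : M.CCell ≃ M.CCell :=
    { toFun := fun c => Function.update c d (r (c d))
      invFun := fun c => Function.update c d (r.symm (c d))
      left_inv := fun c => by simp
      right_inv := fun c => by simp }
  rw [← Equiv.sum_comp rot fun c => F c Side.lo]
  refine Finset.sum_congr rfl fun c _ => ?_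
  rcases (M.grid d).next_or_wall (M.periodic d) (c d) with h | ⟨hp, h1, h2⟩
  · exact hnext _ _ h
  · rw [hwall hp _ _ h1, hwall hp (rot c) Side.lo (by simpa [rot, r] using h2)]

/-! ### Cells and faces -/

theorem Grid.edge_lo_lt_hi (g : Grid) (i : Fin g.n) : g.edge i Side.lo < g.edge i Side.hi :=
  g.node_strictMono Fin.castSucc_lt_succ

theorem Mesh.cbox_subset_domain (M : Mesh S) (c : M.CCell) : M.cbox c ⊆ M.domain := by
  refine Set.Icc_subset_Icc (fun d => ?_) (fun d => ?_)
  · exact (M.grid d).node_strictMono.monotone (Fin.zero_le _)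
  · exact (M.grid d).node_strictMono.monotone (Fin.le_last _)

theorem Mesh.isCompact_cbox (M : Mesh S) (c : M.CCell) : IsCompact (M.cbox c) := isCompact_Icc

theorem Mesh.isCompact_vbox (M : Mesh S) {s : S} (k : M.VCell s) : IsCompact (M.vbox k) :=
  isCompact_Icc.prod isCompact_Icc

theorem Mesh.atFace_mem_cbox (M : Mesh S) {c : M.CCell} {d : Fin 3} {y : Fin 2 → ℝ}
    (hy : y ∈ M.cface c d) (e : Side) : atFace d ((M.grid d).edge (c d) e) y ∈ M.cbox c := by
  have h := ((M.grid d).edge_lo_lt_hi (c d)).le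
  refine ⟨fun j => ?_, fun j => ?_⟩
  · induction j using Fin.succAboveCases d with
    | x => cases e <;> simp [atFace, h]
    | p j => simpa [atFace] using hy.1 j
  · induction j using Fin.succAboveCases d with
    | x => cases e <;> simp [atFace, h]
    | p j => simpa [atFace] using hy.2 j

theorem Mesh.cface_update (M : Mesh S) (c : M.CCell) (d : Fin 3) (i : Fin (M.grid d).n) :
    M.cface (Function.update c d i) d = M.cface c d := by
  simp [Mesh.cface, Fin.succAbove_ne]

theorem atFace_eq_update (d : Fin 3) (a b : ℝ) (y : Fin 2 → ℝ) :
    atFace d a y = Function.update (atFace d b y) d a := by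
  simp [atFace, Fin.update_insertNth]

theorem pt_update (R : Fin 3 → ℝ) (w : ℝ × ℝ) (d : Fin 3) (a : ℝ) :
    pt (Function.update R d a) w = Function.update (pt R w) (Fin.castAdd 2 d) a := by
  ext j
  fin_cases d <;> fin_cases j <;> simp [pt, Function.update]

theorem pt_atFace (d : Fin 3) (a b : ℝ) (y : Fin 2 → ℝ) (w : ℝ × ℝ) :
    pt (atFace d a y) w = Function.update (pt (atFace d b y) w) (Fin.castAdd 2 d) a := by
  rw [atFace_eq_update d a b, pt_update]

theorem pt_vpar (R : Fin 3 → ℝ) (v v' mu : ℝ) :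
    pt R (v, mu) = Function.update (pt R (v', mu)) 3 v := by
  ext j
  fin_cases j <;> simp [pt, Function.update]

theorem eq_pt (z : Fin 5 → ℝ) : z = pt (fun d => z (Fin.castAdd 2 d)) (z 3, z 4) := by
  ext j
  fin_cases j <;> rfl

theorem eq_atFace (d : Fin 3) (R : Fin 3 → ℝ) : R = atFace d (R d) fun j => R (d.succAbove j) := by
  exact (Fin.insertNth_self_removeNth d R).symm

/-- The ranges of the five coordinates in a phase-space cell. -/
def Mesh.ranges (M : Mesh S) {s : S} (c : M.CCell) (k : M.VCell s) : Fin 5 → Set ℝ :=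
  Fin.append (fun d => Set.Icc ((M.grid d).edge (c d) Side.lo) ((M.grid d).edge (c d) Side.hi))
    ![M.vparBox k, M.muBox k]

theorem Mesh.ranges_infinite (M : Mesh S) {s : S} (c : M.CCell) (k : M.VCell s) (j : Fin 5) :
    (M.ranges c k j).Infinite := by
  induction j using Fin.addCases (m := 3) (n := 2) with
  | left d =>
    simpa only [Mesh.ranges, Fin.append_left] using
      Set.Icc_infinite ((M.grid d).edge_lo_lt_hi (c d))
  | right j =>
    simp only [Mesh.ranges, Fin.append_right]
    fin_cases j
    · exact Set.Icc_infinite (Grid.edge_lo_lt_hi _ _)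
    · exact Set.Icc_infinite (Grid.edge_lo_lt_hi _ _)

theorem Mesh.mem_of_mem_ranges (M : Mesh S) {s : S} {c : M.CCell} {k : M.VCell s}
    {z : Fin 5 → ℝ} (hz : z ∈ Set.univ.pi (M.ranges c k)) :
    (∀ d, z (Fin.castAdd 2 d) ∈
      Set.Icc ((M.grid d).edge (c d) Side.lo) ((M.grid d).edge (c d) Side.hi)) ∧
      z 3 ∈ M.vparBox k ∧ z 4 ∈ M.muBox k := by
  refine ⟨fun d => ?_, ?_, ?_⟩
  · simpa only [Mesh.ranges, Fin.append_left] using hz (Fin.castAdd 2 d) trivial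
  · exact hz 3 trivial
  · exact hz 4 trivial

/-! ### Tangential derivatives at the interfaces -/

section Traces

variable {M : Mesh S} {P : Submodule ℝ Poly5} {s : S} {H : M.PFun s}

/-- Tangential derivatives of a continuous function agree at the interfaces in configuration
space. -/
theorem Mesh.pderiv_eq_across_R (hH : H ∈ M.VhCont P s) {d : Fin 3} {c : M.CCell}
    {i : Fin (M.grid d).n} (hi : (M.grid d).Next (M.periodic d) (c d) i) (k : M.VCell s)
    {j : Fin 5} (hj : j ≠ Fin.castAdd 2 d) (y : Fin 2 → ℝ) (w : ℝ × ℝ) :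
    MvPolynomial.eval (pt (atFace d ((M.grid d).edge (c d) Side.hi) y) w)
        (MvPolynomial.pderiv j (H c k)) =
      MvPolynomial.eval (pt (atFace d ((M.grid d).edge i Side.lo) y) w)
        (MvPolynomial.pderiv j (H (Function.update c d i) k)) := by
  rw [pt_atFace d _ 0, pt_atFace d ((M.grid d).edge i Side.lo) 0]
  refine pderiv_eq_of_trace_eq (M.ranges c k) (M.ranges_infinite c k) (fun z hz => ?_) hj _
  obtain ⟨hc, hv, hmu⟩ := M.mem_of_mem_ranges hz
  have hz' : ∀ a, Function.update z (Fin.castAdd 2 d) a =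
      pt (atFace d a fun j => z (Fin.castAdd 2 (d.succAbove j))) (z 3, z 4) := by
    intro a
    conv_lhs => rw [eq_pt z, eq_atFace d fun d => z (Fin.castAdd 2 d)]
    rw [← pt_atFace]
  rw [hz', hz']
  exact hH.2.1 d c i hi k _ ⟨fun j => (hc _).1, fun j => (hc _).2⟩ _ ⟨hv, hmu⟩

/-- Tangential derivatives of a continuous function agree at the interfaces orthogonal to
`v_∥`. -/
theorem Mesh.pderiv_eq_across_vpar (hH : H ∈ M.VhCont P s) (c : M.CCell) {k : M.VCell s}
    {i : Fin (M.vGrid s).n} (hi : (M.vGrid s).Next False k.1 i)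
    {j : Fin 5} (hj : j ≠ 3) (R : Fin 3 → ℝ) (mu : ℝ) :
    MvPolynomial.eval (pt R ((M.vGrid s).edge k.1 Side.hi, mu))
        (MvPolynomial.pderiv j (H c k)) =
      MvPolynomial.eval (pt R ((M.vGrid s).edge i Side.lo, mu))
        (MvPolynomial.pderiv j (H c (i, k.2))) := by
  rw [pt_vpar R _ 0, pt_vpar R ((M.vGrid s).edge i Side.lo) 0]
  refine pderiv_eq_of_trace_eq (M.ranges c k) (M.ranges_infinite c k) (fun z hz => ?_) hj _
  obtain ⟨hc, -, hmu⟩ := M.mem_of_mem_ranges hz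
  have hz' : ∀ a, Function.update z 3 a = pt (fun d => z (Fin.castAdd 2 d)) (a, z 4) := by
    intro a
    conv_lhs => rw [eq_pt z]
    rw [← pt_vpar]
  rw [hz', hz']
  exact hH.2.2.1 c k i hi _ ⟨fun d => (hc d).1, fun d => (hc d).2⟩ _ hmu

theorem Mesh.pderiv_eq_of_contAcross {g : M.CFun} {d : Fin 3} (hg : M.ContAcross d g)
    {c : M.CCell} {i : Fin (M.grid d).n} (hi : (M.grid d).Next (M.periodic d) (c d) i)
    {j : Fin 3} (hj : j ≠ d) (y : Fin 2 → ℝ) :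
    MvPolynomial.eval (atFace d ((M.grid d).edge (c d) Side.hi) y)
        (MvPolynomial.pderiv j (g c)) =
      MvPolynomial.eval (atFace d ((M.grid d).edge i Side.lo) y)
        (MvPolynomial.pderiv j (g (Function.update c d i))) := by
  rw [atFace_eq_update d _ 0, atFace_eq_update d ((M.grid d).edge i Side.lo) 0]
  refine pderiv_eq_of_trace_eq
    (fun d => Set.Icc ((M.grid d).edge (c d) Side.lo) ((M.grid d).edge (c d) Side.hi))
    (fun d => Set.Icc_infinite ((M.grid d).edge_lo_lt_hi (c d))) (fun z hz => ?_) hj _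
  have hz' : ∀ a, Function.update z d a = atFace d a fun j => z (d.succAbove j) := by
    intro a
    conv_lhs => rw [eq_atFace d z]
    rw [← atFace_eq_update]
  rw [hz', hz']
  exact hg c i hi _ ⟨fun j => (hz _ trivial).1, fun j => (hz _ trivial).2⟩

end Traces

/-! ### The Poisson bracket -/

section Bracket

variable {M : Mesh S} (E : Plasma M) (s : S)

theorem Plasma.bracket_self (gA R : Fin 3 → ℝ) (v : ℝ) (g : Fin 3 → ℝ) (a : ℝ) :
    E.bracket s gA R v g a g a = 0 := by
  simp [Plasma.bracket, dotProduct_comm _ g]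

/-- The bracket with a function is the derivative along its Hamiltonian vector field. -/
theorem Plasma.bracket_eq_sum (gA R : Fin 3 → ℝ) (v : ℝ) (g h : Fin 3 → ℝ) (a b : ℝ) :
    ∑ d, E.bracket s gA R v (Pi.single d 1) 0 h b * g d + E.bracket s gA R v 0 1 h b * a =
      E.bracket s gA R v g a h b := by
  simp only [Plasma.bracket, Fin.sum_univ_three, cross_apply, bvec, dotProduct]
  simp
  ring

/-- The component `d` of the characteristics only involves tangential derivatives of the
Hamiltonian and of the vector potential on the faces orthogonal to direction `d`. The
`z`-component does not involve the vector potential, as `∇A_∥ × b` is perpendicular to `b`. -/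
theorem Plasma.bracket_coord_congr (d : Fin 3) {gA gA' R R' : Fin 3 → ℝ} (v : ℝ)
    {h h' : Fin 3 → ℝ} {b b' : ℝ} (hB : E.B R = E.B R') (hcurl : E.curlb R = E.curlb R')
    (hA : d ≠ 2 → ∀ j ≠ d, gA j = gA' j) (hh : ∀ j ≠ d, h j = h' j) (hb : b = b') :
    E.bracket s gA R v (Pi.single d 1) 0 h b = E.bracket s gA' R' v (Pi.single d 1) 0 h' b' := by
  subst hb
  simp only [Plasma.bracket, Plasma.Bstar, hB, hcurl]
  fin_cases d
  · have h1 := hA (by decide) 1 (by decide)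
    have h2 := hh 1 (by decide)
    simp [bvec, cross_apply, dotProduct, Fin.sum_univ_three, Pi.single_apply, h1, h2]
  · have h1 := hA (by decide) 0 (by decide)
    have h2 := hh 0 (by decide)
    simp [bvec, cross_apply, dotProduct, Fin.sum_univ_three, Pi.single_apply, h1, h2]
  · simp [bvec, cross_apply, dotProduct, Fin.sum_univ_three, Pi.single_apply]

theorem Plasma.equilibrium_eq_across {d : Fin 3} {c : M.CCell} {i : Fin (M.grid d).n}
    (hi : (M.grid d).Next (M.periodic d) (c d) i) {y : Fin 2 → ℝ} (hy : y ∈ M.cface c d) :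
    E.B (atFace d ((M.grid d).edge (c d) Side.hi) y) =
        E.B (atFace d ((M.grid d).edge i Side.lo) y) ∧
      E.curlb (atFace d ((M.grid d).edge (c d) Side.hi) y) =
        E.curlb (atFace d ((M.grid d).edge i Side.lo) y) := by
  have hmem := M.cbox_subset_domain c (M.atFace_mem_cbox hy Side.hi)
  rcases hi.edge_eq with h | ⟨hp, h1, h2⟩
  · rw [h]; exact ⟨rfl, rfl⟩
  · rw [h1] at hmem ⊢
    rw [h2]
    exact ⟨E.B_periodic d hp y hmem, E.curlb_periodic d hp y hmem⟩

end Bracket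

/-! ### Cancellation of the surface terms -/

section Surface

variable {M : Mesh S} (E : Plasma M) (D : Discretization M) (U : Unknowns M) {s : S} {t : ℝ}

theorem Rdot_eq_across (hH : Ham E D U s t ∈ M.VhCont D.P s)
    (hA : U.A t ∈ M.XhPerp D.P D.dirA) {d : Fin 3} {c : M.CCell}
    {i : Fin (M.grid d).n} (hi : (M.grid d).Next (M.periodic d) (c d) i) (k : M.VCell s)
    {y : Fin 2 → ℝ} (hy : y ∈ M.cface c d) (w : ℝ × ℝ) :
    Rdot E D U s t c k d (atFace d ((M.grid d).edge (c d) Side.hi) y) w =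
      Rdot E D U s t (Function.update c d i) k d (atFace d ((M.grid d).edge i Side.lo) y) w := by
  obtain ⟨hB, hcurl⟩ := E.equilibrium_eq_across hi hy
  refine E.bracket_coord_congr s d w.1 hB hcurl (fun hd j hj => ?_) (fun j hj => ?_) ?_
  · refine Mesh.pderiv_eq_of_contAcross (hA.1.2 d ?_) hi hj y
    fin_cases d <;> simp at hd ⊢
  · exact Mesh.pderiv_eq_across_R hH hi k (fun h => hj (Fin.castAdd_injective 3 2 h)) y w
  · refine Mesh.pderiv_eq_across_R hH hi k ?_ y w
    fin_cases d <;> decide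

theorem vdot_eq_across (hH : Ham E D U s t ∈ M.VhCont D.P s) (c : M.CCell) {k : M.VCell s}
    {i : Fin (M.vGrid s).n} (hi : (M.vGrid s).Next False k.1 i) (R : Fin 3 → ℝ) (mu : ℝ) :
    vdot E D U s t c k R ((M.vGrid s).edge k.1 Side.hi, mu) =
      vdot E D U s t c (i, k.2) R ((M.vGrid s).edge i Side.lo, mu) := by
  have he : (M.vGrid s).edge k.1 Side.hi = (M.vGrid s).edge i Side.lo := by
    rcases hi.edge_eq with h | h
    · exact h
    · exact h.1.elim
  have hg : grad5 (Ham E D U s t c k) R ((M.vGrid s).edge k.1 Side.hi, mu) =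
      grad5 (Ham E D U s t c (i, k.2)) R ((M.vGrid s).edge i Side.lo, mu) := by
    funext d
    refine Mesh.pderiv_eq_across_vpar hH c hi ?_ R mu
    fin_cases d <;> decide
  unfold vdot vdotH
  rw [hg, ← he]
  simp [Plasma.bracket]

theorem sum_surfR_eq_zero (hH : Ham E D U s t ∈ M.VhCont D.P s)
    (hA : U.A t ∈ M.XhPerp D.P D.dirA) (k : M.VCell s) (d : Fin 3) :
    ∑ c, (surfR E D U s t c k (Ham E D U s t c k) d Side.hi -
      surfR E D U s t c k (Ham E D U s t c k) d Side.lo) = 0 := by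
  rw [Finset.sum_sub_distrib, sub_eq_zero]
  refine M.sum_hi_eq_sum_lo d (fun c e => surfR E D U s t c k (Ham E D U s t c k) d e) ?_ ?_
  · intro c i hi
    simp only [surfR, M.cface_update, Function.update_self]
    -- The integrands agree pointwise, so that no integrability of the flux is needed.
    refine MeasureTheory.setIntegral_congr_fun measurableSet_Icc fun y hy => ?_
    refine MeasureTheory.setIntegral_congr_fun (measurableSet_Icc.prod measurableSet_Icc)
      fun w hw => ?_
    simp only []
    rw [Rdot_eq_across E D U hH hA hi k hy w, hH.2.1 d c i hi k y hy w hw,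
      (U.flux s t).R_single c k d i hi]
  · intro hp c e he
    simp [surfR, (U.flux s t).R_boundary c k d hp e he, Plasma.wInt]

theorem sum_surfV_eq_zero (hH : Ham E D U s t ∈ M.VhCont D.P s) (c : M.CCell) :
    ∑ k, (surfV E D U s t c k (Ham E D U s t c k) Side.hi -
      surfV E D U s t c k (Ham E D U s t c k) Side.lo) = 0 := by
  rw [Fintype.sum_prod_type_right]
  refine Finset.sum_eq_zero fun l _ => ?_
  rw [Finset.sum_sub_distrib, sub_eq_zero]
  refine (M.vGrid s).sum_hi_eq_sum_lo False
    (fun i e => surfV E D U s t c (i, l) (Ham E D U s t c (i, l)) e) ?_ ?_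
  · intro j i hi
    refine MeasureTheory.setIntegral_congr_fun measurableSet_Icc fun R hR => ?_
    refine MeasureTheory.setIntegral_congr_fun measurableSet_Icc fun mu hmu => ?_
    simp only []
    rw [vdot_eq_across E D U hH c (k := (j, l)) hi R mu, hH.2.2.1 c (j, l) i hi R hR mu hmu,
      (U.flux s t).V_single c (j, l) i hi]
  · intro _ i e he
    simp [surfV, (U.flux s t).V_boundary c (i, l) e he]

end Surface

/-! ### Integrals over cells as linear functionals -/

theorem continuous_eval_pt (p : Poly5) :
    Continuous fun z : (Fin 3 → ℝ) × (ℝ × ℝ) => MvPolynomial.eval (pt z.1 z.2) p := by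
  refine (MvPolynomial.continuous_eval p).comp (continuous_pi fun j => ?_)
  fin_cases j <;> simp [pt] <;> fun_prop

theorem eval_emb (p : Poly3) (R : Fin 3 → ℝ) (w : ℝ × ℝ) :
    MvPolynomial.eval (pt R w) (emb p) = MvPolynomial.eval R p := by
  have h : pt R w ∘ Fin.castAdd 2 = R := by
    ext j
    fin_cases j <;> rfl
  rw [emb, MvPolynomial.eval_rename, h]

section CellIntegrals

variable {M : Mesh S} (E : Plasma M) {s : S} (c : M.CCell) (k : M.VCell s)

theorem Plasma.integrableOn_phase {F : (Fin 3 → ℝ) → ℝ × ℝ → ℝ}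
    (hF : ContinuousOn (fun z : (Fin 3 → ℝ) × (ℝ × ℝ) => F z.1 z.2) (M.cbox c ×ˢ M.vbox k)) :
    MeasureTheory.IntegrableOn (fun z : (Fin 3 → ℝ) × (ℝ × ℝ) => 2 * Real.pi / E.m s * F z.1 z.2)
      (M.cbox c ×ˢ M.vbox k) (MeasureTheory.volume.prod MeasureTheory.volume) :=
  (continuousOn_const.mul hF).integrableOn_compact ((M.isCompact_cbox c).prod (M.isCompact_vbox k))

theorem Plasma.integrableOn_wInt {F : (Fin 3 → ℝ) → ℝ × ℝ → ℝ}
    (hF : ContinuousOn (fun z : (Fin 3 → ℝ) × (ℝ × ℝ) => F z.1 z.2) (M.cbox c ×ˢ M.vbox k)) :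
    MeasureTheory.IntegrableOn (fun R => E.wInt k (F R)) (M.cbox c) := by
  have h := E.integrableOn_phase c k hF
  rw [MeasureTheory.IntegrableOn, ← MeasureTheory.Measure.prod_restrict] at h
  exact h.integral_prod_left

theorem Plasma.pInt_add {F G : (Fin 3 → ℝ) → ℝ × ℝ → ℝ}
    (hF : ContinuousOn (fun z : (Fin 3 → ℝ) × (ℝ × ℝ) => F z.1 z.2) (M.cbox c ×ˢ M.vbox k))
    (hG : ContinuousOn (fun z : (Fin 3 → ℝ) × (ℝ × ℝ) => G z.1 z.2) (M.cbox c ×ˢ M.vbox k)) :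
    E.pInt c k (fun R w => F R w + G R w) = E.pInt c k F + E.pInt c k G := by
  have key : ∀ F : (Fin 3 → ℝ) → ℝ × ℝ → ℝ,
      ContinuousOn (fun z : (Fin 3 → ℝ) × (ℝ × ℝ) => F z.1 z.2) (M.cbox c ×ˢ M.vbox k) →
      E.pInt c k F = ∫ z in M.cbox c ×ˢ M.vbox k, 2 * Real.pi / E.m s * F z.1 z.2
        ∂(MeasureTheory.volume.prod MeasureTheory.volume) := fun F hF =>
    (MeasureTheory.setIntegral_prod _ (E.integrableOn_phase c k hF)).symm
  rw [key _ hF, key _ hG, key (fun R w => F R w + G R w) (hF.add hG),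
    ← MeasureTheory.integral_add (E.integrableOn_phase c k hF) (E.integrableOn_phase c k hG)]
  simp only [mul_add]

theorem Plasma.wInt_const_mul (a : ℝ) (F : ℝ × ℝ → ℝ) :
    E.wInt k (fun w => a * F w) = a * E.wInt k F := by
  simp only [Plasma.wInt, mul_left_comm _ a]
  exact MeasureTheory.integral_const_mul _ _

theorem Plasma.pInt_const_mul (a : ℝ) (F : (Fin 3 → ℝ) → ℝ × ℝ → ℝ) :
    E.pInt c k (fun R w => a * F R w) = a * E.pInt c k F := by
  simp only [Plasma.pInt, E.wInt_const_mul]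
  exact MeasureTheory.integral_const_mul _ _

theorem Plasma.continuousOn_B : ContinuousOn E.B (M.cbox c) :=
  E.B_cont.mono (M.cbox_subset_domain c)

theorem Plasma.continuousOn_density (p : Poly5) :
    ContinuousOn (fun z : (Fin 3 → ℝ) × (ℝ × ℝ) => E.B z.1 * MvPolynomial.eval (pt z.1 z.2) p)
      (M.cbox c ×ˢ M.vbox k) :=
  ((E.continuousOn_B c).comp continuousOn_fst fun _ hz => hz.1).mul
    (continuous_eval_pt p).continuousOn

/-- The functional `p ↦ ∫_K B p dR dw` on polynomials. -/
noncomputable def Plasma.phaseInt : Poly5 →ₗ[ℝ] ℝ where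
  toFun p := E.pInt c k fun R w => E.B R * MvPolynomial.eval (pt R w) p
  map_add' p q := by
    rw [← E.pInt_add c k (E.continuousOn_density c k p) (E.continuousOn_density c k q)]
    simp only [map_add, mul_add]
  map_smul' a p := by
    rw [RingHom.id_apply, smul_eq_mul, ← E.pInt_const_mul]
    simp only [MvPolynomial.smul_eval, mul_left_comm]

theorem Plasma.phaseInt_apply (p : Poly5) :
    E.phaseInt c k p = E.pInt c k fun R w => E.B R * MvPolynomial.eval (pt R w) p := rfl

/-- The functional `p ↦ ∫_{K^R} g p dR` on polynomials, for a continuous weight `g`. -/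
noncomputable def Mesh.weightInt (M : Mesh S) {g : (Fin 3 → ℝ) → ℝ} (hg : ContinuousOn g M.domain)
    (c : M.CCell) : Poly3 →ₗ[ℝ] ℝ where
  toFun p := ∫ R in M.cbox c, g R * MvPolynomial.eval R p
  map_add' p q := by
    have h : ∀ p : Poly3, MeasureTheory.IntegrableOn (fun R => g R * MvPolynomial.eval R p)
        (M.cbox c) := fun p =>
      ((hg.mono (M.cbox_subset_domain c)).mul
        (MvPolynomial.continuous_eval p).continuousOn).integrableOn_compact (M.isCompact_cbox c)
    rw [← MeasureTheory.integral_add (h p) (h q)]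
    simp only [map_add, mul_add]
  map_smul' a p := by
    rw [RingHom.id_apply, smul_eq_mul, ← MeasureTheory.integral_const_mul]
    simp only [MvPolynomial.smul_eval, mul_left_comm]

/-- Moments in velocity space, tested against a piecewise polynomial on configuration space. -/
theorem Plasma.cInt_mul_moment [Fintype S] (a : S → ℝ) (p : (s : S) → M.PFun s) (g : M.CFun) :
    M.cInt (fun c R => MvPolynomial.eval R (g c) * ∑ s, a s * ∑ k : M.VCell s,
        E.wInt k fun w => E.B R * MvPolynomial.eval (pt R w) (p s c k)) =
      ∑ s, a s * ∑ c, ∑ k, E.phaseInt c k (p s c k * emb (g c)) := by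
  have hterm : ∀ c R, MvPolynomial.eval R (g c) * ∑ s, a s * ∑ k : M.VCell s,
      E.wInt k (fun w => E.B R * MvPolynomial.eval (pt R w) (p s c k)) =
      ∑ s, a s * ∑ k : M.VCell s,
        E.wInt k fun w => E.B R * MvPolynomial.eval (pt R w) (p s c k * emb (g c)) := by
    intro c R
    rw [Finset.mul_sum]
    refine Finset.sum_congr rfl fun s _ => ?_
    rw [mul_left_comm, Finset.mul_sum]
    simp only [← E.wInt_const_mul, map_mul, eval_emb]
    congr 1
    refine Finset.sum_congr rfl fun k _ => ?_
    congr 1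
    funext w
    ring
  have hint : ∀ (s : S) (c : M.CCell) (k : M.VCell s), MeasureTheory.IntegrableOn
      (fun R => E.wInt k fun w => E.B R * MvPolynomial.eval (pt R w) (p s c k * emb (g c)))
      (M.cbox c) := fun s c k => E.integrableOn_wInt c k (E.continuousOn_density c k _)
  simp only [Mesh.cInt, hterm]
  simp only [Finset.mul_sum]
  rw [Finset.sum_comm]
  refine Finset.sum_congr rfl fun c _ => ?_
  rw [MeasureTheory.integral_finsetSum _ fun s _ =>
    MeasureTheory.integrable_finsetSum _ fun k _ => (hint s c k).const_mul (a s)]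
  refine Finset.sum_congr rfl fun s _ => ?_
  rw [MeasureTheory.integral_finsetSum _ fun k _ => (hint s c k).const_mul (a s)]
  refine Finset.sum_congr rfl fun k _ => ?_
  rw [MeasureTheory.integral_const_mul]
  rfl

end CellIntegrals

/-! ### Testing the kinetic equation with the Hamiltonian -/

section Kinetic

variable {M : Mesh S} (E : Plasma M) (D : Discretization M) (U : Unknowns M) {s : S} {t : ℝ}

theorem Plasma.continuousOn_bracket (s : S) {c : M.CCell} {k : M.VCell s}
    {gA : (Fin 3 → ℝ) → Fin 3 → ℝ} {h : (Fin 3 → ℝ) × (ℝ × ℝ) → Fin 3 → ℝ}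
    {b : (Fin 3 → ℝ) × (ℝ × ℝ) → ℝ} (hA : Continuous gA) (hh : Continuous h) (hb : Continuous b)
    (g : Fin 3 → ℝ) (a : ℝ) :
    ContinuousOn (fun z : (Fin 3 → ℝ) × (ℝ × ℝ) => E.bracket s (gA z.1) z.1 z.2.1 g a (h z) (b z))
      (M.cbox c ×ˢ M.vbox k) := by
  have hB : ContinuousOn (fun z : (Fin 3 → ℝ) × (ℝ × ℝ) => E.B z.1) (M.cbox c ×ˢ M.vbox k) :=
    (E.continuousOn_B c).comp continuousOn_fst fun _ hz => hz.1
  have hB0 : ∀ z ∈ M.cbox c ×ˢ M.vbox k, E.B z.1 ≠ 0 := fun z hz =>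
    (E.B_pos _ (M.cbox_subset_domain c hz.1)).ne'
  have hcurl : ContinuousOn (fun z : (Fin 3 → ℝ) × (ℝ × ℝ) => E.curlb z.1)
      (M.cbox c ×ˢ M.vbox k) :=
    (E.curlb_cont.mono (M.cbox_subset_domain c)).comp continuousOn_fst fun _ hz => hz.1
  have hcurl' := continuousOn_pi.1 hcurl
  have hinv : ∀ r : ℝ, r ≠ 0 → ContinuousOn
      (fun z : (Fin 3 → ℝ) × (ℝ × ℝ) => 1 / (r * E.B z.1)) (M.cbox c ×ˢ M.vbox k) := fun r hr =>
    continuousOn_const.div (continuousOn_const.mul hB) fun z hz => mul_ne_zero hr (hB0 z hz)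
  have hA' := fun d => (continuous_pi_iff.1 hA d).comp
    (continuous_fst : Continuous fun z : (Fin 3 → ℝ) × (ℝ × ℝ) => z.1)
  have hh' := continuous_pi_iff.1 hh
  refine ContinuousOn.sub ((hinv _ (E.m_pos s).ne').mul ?_) ((hinv _ (E.q_ne s)).mul ?_)
  · simp only [dotProduct, Plasma.Bstar]
    refine continuousOn_finsetSum _ fun d _ => ContinuousOn.mul ?_ ?_
    · simp only [Pi.add_apply, Pi.smul_apply, smul_eq_mul]
      refine ((hB.mul continuousOn_const).add (ContinuousOn.mul (by fun_prop) (hcurl' d))).add ?_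
      refine Continuous.continuousOn ?_
      have h0 := hA' 0
      have h1 := hA' 1
      have h2 := hA' 2
      simp only [Function.comp_def] at h0 h1 h2
      fin_cases d <;> simp [cross_apply, bvec] <;> fun_prop
    · exact Continuous.continuousOn (by fun_prop)
  · exact Continuous.continuousOn (by simp only [dotProduct]; fun_prop)

/-- The volume terms of the weak form with the Hamiltonian as test function: as `{H, H} = 0`, only
the inductive acceleration `-(q/m) ∂A_∥/∂t` contributes. -/
theorem volume_terms_eq (c : M.CCell) (k : M.VCell s) :
    E.pInt c k (fun R w => E.B R * MvPolynomial.eval (pt R w) (U.f s t c k) *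
        ∑ d : Fin 3, Rdot E D U s t c k d R w * grad5 (Ham E D U s t c k) R w d) +
      E.pInt c k (fun R w => E.B R * MvPolynomial.eval (pt R w) (U.f s t c k) *
        vdot E D U s t c k R w * dvpar (Ham E D U s t c k) R w) =
      -(E.q s / E.m s * E.phaseInt c k
        (MvPolynomial.pderiv 3 (Ham E D U s t c k) * U.f s t c k * emb (U.A' t c))) := by
  have hA : Continuous (grad3 (U.A t c)) :=
    continuous_pi fun d => MvPolynomial.continuous_eval _
  have hg : Continuous fun z : (Fin 3 → ℝ) × (ℝ × ℝ) => grad5 (Ham E D U s t c k) z.1 z.2 :=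
    continuous_pi fun d => continuous_eval_pt _
  have hv : Continuous fun z : (Fin 3 → ℝ) × (ℝ × ℝ) => dvpar (Ham E D U s t c k) z.1 z.2 :=
    continuous_eval_pt _
  have hbr := E.continuousOn_bracket s (c := c) (k := k) hA hg hv
  have hf := E.continuousOn_density c k (U.f s t c k)
  rw [← E.pInt_add c k]
  · rw [Plasma.phaseInt_apply, ← neg_mul, ← E.pInt_const_mul]
    congr 1
    funext R w
    have h0 : ∑ d, Rdot E D U s t c k d R w * grad5 (Ham E D U s t c k) R w d +
        vdotH E D U s t c k R w * dvpar (Ham E D U s t c k) R w = 0 :=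
      (E.bracket_eq_sum s _ _ _ _ _ _ _).trans (E.bracket_self s _ _ _ _ _)
    simp only [vdot, map_mul, eval_emb]
    change _ = -(E.q s / E.m s) * (E.B R * (dvpar (Ham E D U s t c k) R w * _ * _))
    linear_combination (E.B R * MvPolynomial.eval (pt R w) (U.f s t c k)) * h0
  · exact hf.mul (continuousOn_finsetSum _ fun d _ =>
      (hbr _ _).mul (continuous_pi_iff.1 hg d).continuousOn)
  · refine (hf.mul (ContinuousOn.sub (hbr _ _) ?_)).mul hv.continuousOn
    exact (continuous_const.mul
      ((MvPolynomial.continuous_eval (U.A' t c)).comp continuous_fst)).continuousOn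

/-- Summed over all cells, the surface terms cancel, and `∫ J H ∂_t f` equals minus the work done
by the inductive electric field. -/
theorem sum_phaseInt_Ham_mul_deriv (hH : Ham E D U s t ∈ M.VhCont D.P s)
    (hA : U.A t ∈ M.XhPerp D.P D.dirA)
    (hweak : ∀ c k, ∀ psi ∈ D.P, WeakGK E D U s t c k psi) :
    ∑ c, ∑ k, E.phaseInt c k (U.f' s t c k * Ham E D U s t c k) =
      -(E.q s / E.m s * ∑ c, ∑ k, E.phaseInt c k
        (MvPolynomial.pderiv 3 (Ham E D U s t c k) * U.f s t c k * emb (U.A' t c))) := by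
  have hcell : ∀ c k, E.phaseInt c k (U.f' s t c k * Ham E D U s t c k) =
      -(E.q s / E.m s * E.phaseInt c k
        (MvPolynomial.pderiv 3 (Ham E D U s t c k) * U.f s t c k * emb (U.A' t c))) -
      ∑ d : Fin 3, (surfR E D U s t c k (Ham E D U s t c k) d Side.hi -
        surfR E D U s t c k (Ham E D U s t c k) d Side.lo) -
      (surfV E D U s t c k (Ham E D U s t c k) Side.hi -
        surfV E D U s t c k (Ham E D U s t c k) Side.lo) := by
    intro c k
    have h := hweak c k _ (hH.1 c k)
    have h1 : E.phaseInt c k (U.f' s t c k * Ham E D U s t c k) =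
        E.pInt c k (fun R w => MvPolynomial.eval (pt R w) (Ham E D U s t c k) *
          (E.B R * MvPolynomial.eval (pt R w) (U.f' s t c k))) := by
      rw [Plasma.phaseInt_apply]
      congr 1
      funext R w
      rw [map_mul]
      ring
    rw [← volume_terms_eq, h1]
    unfold WeakGK at h
    linarith
  have hR : ∑ c, ∑ k, ∑ d : Fin 3, (surfR E D U s t c k (Ham E D U s t c k) d Side.hi -
      surfR E D U s t c k (Ham E D U s t c k) d Side.lo) = 0 := by
    rw [Finset.sum_comm]
    refine Finset.sum_eq_zero fun k _ => ?_
    rw [Finset.sum_comm]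
    exact Finset.sum_eq_zero fun d _ => sum_surfR_eq_zero E D U hH hA k d
  simp only [hcell, Finset.sum_sub_distrib] at hR ⊢
  have hV := Finset.sum_eq_zero fun c (_ : c ∈ Finset.univ) => sum_surfV_eq_zero E D U hH c
  simp only [Finset.sum_sub_distrib] at hV
  rw [hR, hV]
  simp only [Finset.sum_neg_distrib, Finset.mul_sum, sub_zero]

end Kinetic

/-! ### Time derivatives of the energies -/

/-- Configuration-space polynomials that lie in `P` form a finite-dimensional space. -/
theorem finiteDimensional_comap_emb (P : Submodule ℝ Poly5) [FiniteDimensional ℝ P] :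
    FiniteDimensional ℝ (P.comap emb.toLinearMap) := by
  have hinj : Function.Injective emb :=
    MvPolynomial.rename_injective _ (Fin.castAdd_injective 3 2)
  exact Module.Finite.of_injective
    (emb.toLinearMap.restrict (p := P.comap emb.toLinearMap) (q := P) fun _ hx => hx)
    fun x y hxy => Subtype.ext (hinj (congrArg Subtype.val hxy))

theorem HasWeakDeriv.of_coeff_Xh {M : Mesh S} {P : Submodule ℝ Poly5} [FiniteDimensional ℝ P]
    {I : Set ℝ} {t : ℝ} (hacc : AccPt t (Filter.principal I)) (ht : t ∈ I) {u : ℝ → M.CFun}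
    {u' : M.CFun} (hu : ∀ τ ∈ I, u τ ∈ M.Xh P)
    (h : ∀ c a, HasDerivWithinAt (fun τ => (u τ c).coeff a) ((u' c).coeff a) I t) :
    HasWeakDeriv u u' I t := by
  have := finiteDimensional_comap_emb P
  exact HasWeakDeriv.pi fun c =>
    HasWeakDeriv.of_coeff hacc ht (P.comap emb.toLinearMap) (fun τ hτ => hu τ hτ c) (h c)

/-- Derivative of a weighted perpendicular Dirichlet energy. -/
theorem hasDerivWithinAt_cInt_perpDot {M : Mesh S} {P : Submodule ℝ Poly5}
    [FiniteDimensional ℝ P] {g : (Fin 3 → ℝ) → ℝ} (hg : ContinuousOn g M.domain)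
    {I : Set ℝ} {t : ℝ} (hacc : AccPt t (Filter.principal I)) (ht : t ∈ I) {u : ℝ → M.CFun}
    {u' : M.CFun} (hu : ∀ τ ∈ I, u τ ∈ M.Xh P) (h : HasWeakDeriv u u' I t) :
    HasDerivWithinAt (fun τ => M.cInt fun c R => g R * perpDot (u τ c) (u τ c) R)
      (2 * M.cInt fun c R => g R * perpDot (u t c) (u' c) R) I t := by
  have := finiteDimensional_comap_emb P
  let δ : Fin 3 → Poly3 →ₗ[ℝ] Poly3 := fun d => (MvPolynomial.pderiv d).toLinearMap
  let β : M.CCell → Poly3 →ₗ[ℝ] Poly3 →ₗ[ℝ] ℝ := fun c =>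
    ((LinearMap.mul ℝ Poly3).compl₁₂ (δ 0) (δ 0) +
      (LinearMap.mul ℝ Poly3).compl₁₂ (δ 1) (δ 1)).compr₂ (M.weightInt hg c)
  have hβ : ∀ c p q, β c p q = ∫ R in M.cbox c, g R * perpDot p q R := by
    intro c p q
    simp [β, δ, Mesh.weightInt, perpDot, grad3]
  have hsymm : ∀ c p q, β c p q = β c q p := by
    intro c p q
    simp only [hβ, perpDot, mul_comm]
  have hd := HasDerivWithinAt.fun_sum (u := Finset.univ) fun c _ =>
    (h.map (LinearMap.proj c)).bilin (h.map (LinearMap.proj c)) hacc ht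
      (P.comap emb.toLinearMap) (fun τ hτ => hu τ hτ c) (β c)
  simp only [LinearMap.proj_apply] at hd
  have he : (2 * M.cInt fun c R => g R * perpDot (u t c) (u' c) R) =
      ∑ c, (β c (u' c) (u t c) + β c (u t c) (u' c)) := by
    simp only [hsymm _ (u' _), ← two_mul, ← Finset.mul_sum, hβ, Mesh.cInt]
  have hfun : (fun τ => M.cInt fun c R => g R * perpDot (u τ c) (u τ c) R) =
      fun τ => ∑ c, β c (u τ c) (u τ c) := by
    simp only [hβ, Mesh.cInt]
  rw [he, hfun]
  exact hd

section Energies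

variable {M : Mesh S} (E : Plasma M) (D : Discretization M) (U : Unknowns M)

theorem Plasma.continuousOn_epsPerp [Fintype S] : ContinuousOn E.epsPerp M.domain := by
  unfold Plasma.epsPerp
  exact continuousOn_finsetSum _ fun s _ => (continuousOn_const.mul (E.n0_cont s)).div
    (E.B_cont.pow 2) fun R hR => pow_ne_zero 2 (E.B_pos R hR).ne'

theorem hasWeakDeriv_Ham {I : Set ℝ} {t : ℝ} (s : S) (h : HasWeakDeriv U.phi (U.phi' t) I t)
    (c : M.CCell) (k : M.VCell s) :
    HasWeakDeriv (fun τ => Ham E D U s τ c k)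
      (MvPolynomial.C (E.q s) * emb (D.Pz (U.phi' t) c)) I t := by
  let T : M.CFun →ₗ[ℝ] Poly5 := LinearMap.mulLeft ℝ (MvPolynomial.C (E.q s)) ∘ₗ
    emb.toLinearMap ∘ₗ LinearMap.proj c ∘ₗ D.Pz
  exact (h.map T).const_add _

variable [Fintype S]

theorem hasDerivWithinAt_energyH {I : Set ℝ} {t : ℝ} (hacc : AccPt t (Filter.principal I))
    (ht : t ∈ I) (hU : IsSolution E D U I) (h : HasWeakDeriv U.phi (U.phi' t) I t) :
    HasDerivWithinAt (energyH E D U)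
      (∑ s, ∑ c, ∑ k, (E.phaseInt c k (U.f' s t c k * Ham E D U s t c k) +
        E.phaseInt c k (U.f s t c k * (MvPolynomial.C (E.q s) * emb (D.Pz (U.phi' t) c))))) I t := by
  have := D.P_finite
  have hd := HasDerivWithinAt.fun_sum (u := Finset.univ) fun s _ =>
    HasDerivWithinAt.fun_sum (u := Finset.univ) fun (c : M.CCell) _ =>
      HasDerivWithinAt.fun_sum (u := Finset.univ) fun (k : M.VCell s) _ =>
        (HasWeakDeriv.of_coeff hacc ht D.P (fun τ hτ => hU.f_mem s τ hτ c k)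
          (hU.f_deriv s t ht c k)).bilin (hasWeakDeriv_Ham E D U s h c k) hacc ht D.P
            (fun τ hτ => hU.f_mem s τ hτ c k)
            ((LinearMap.mul ℝ Poly5).compr₂ (E.phaseInt c k))
  have hfun : energyH E D U = fun τ => ∑ s, ∑ c, ∑ k,
      E.phaseInt c k (U.f s τ c k * Ham E D U s τ c k) := by
    funext τ
    simp only [energyH, Plasma.phaseInt_apply, map_mul, mul_assoc]
  rw [hfun]
  exact hd

/-- The three energies exchange power only with each other: the charge density does the work
`∫ ε_⊥ ∇_⊥φ · ∇_⊥∂_tφ` and the current density the work `∫ ∇_⊥A · ∇_⊥∂_tA / μ_0`. -/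
theorem hasDerivWithinAt_energy {I : Set ℝ} {t : ℝ} (hacc : AccPt t (Filter.principal I))
    (ht : t ∈ I) (hU : IsSolution E D U I)
    (hH : ∀ s, Ham E D U s t ∈ M.VhCont D.P s) :
    HasDerivWithinAt (energy E D U) 0 I t := by
  have := D.P_finite
  have hphi := HasWeakDeriv.of_coeff_Xh hacc ht (fun τ hτ => (hU.phi_mem τ hτ).1.1)
    (hU.phi_deriv t ht)
  have hA := HasWeakDeriv.of_coeff_Xh hacc ht (fun τ hτ => (hU.A_mem τ hτ).1.1)
    (hU.A_deriv t ht)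
  have hphi' : U.phi' t ∈ M.XhPerp D.P D.dirPhi := hphi.mem hacc ht _ hU.phi_mem
  have hA' : U.A' t ∈ M.XhPerp D.P D.dirA := hA.mem hacc ht _ hU.A_mem
  have hdH := hasDerivWithinAt_energyH E D U hacc ht hU hphi
  have hdE := hasDerivWithinAt_cInt_perpDot (P := D.P)
    (E.continuousOn_epsPerp.div_const 2) hacc ht (fun τ hτ => (hU.phi_mem τ hτ).1.1) hphi
  have hdB := hasDerivWithinAt_cInt_perpDot (P := D.P) (g := fun _ => 1 / (2 * E.mu0))
    continuousOn_const hacc ht (fun τ hτ => (hU.A_mem τ hτ).1.1) hA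
  refine ((hdH.sub hdE).add hdB).congr_deriv ?_
  -- the charge density, tested with the smoothed time derivative of the potential
  have hcharge : ∑ s, ∑ c, ∑ k,
      E.phaseInt c k (U.f s t c k * (MvPolynomial.C (E.q s) * emb (D.Pz (U.phi' t) c))) =
      2 * M.cInt fun c R => E.epsPerp R / 2 * perpDot (U.phi t c) (U.phi' t c) R := by
    have hint : ∀ c, MeasureTheory.IntegrableOn (chargeDensity E U t c) (M.cbox c) := fun c =>
      MeasureTheory.integrable_finsetSum _ fun s _ => (MeasureTheory.integrable_finsetSum _
        fun k _ => E.integrableOn_wInt c k (E.continuousOn_density c k (U.f s t c k))).const_mul _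
    have h1 := (D.PzStar_adjoint _ hint).2 _ hphi'.1.1
    have h2 := E.cInt_mul_moment E.q (fun s => U.f s t) (D.Pz (U.phi' t))
    calc _ = ∑ s, E.q s * ∑ c, ∑ k, E.phaseInt c k (U.f s t c k * emb (D.Pz (U.phi' t) c)) := by
          simp only [Finset.mul_sum]
          refine Finset.sum_congr rfl fun s _ => Finset.sum_congr rfl fun c _ =>
            Finset.sum_congr rfl fun k _ => ?_
          rw [← MvPolynomial.smul_eq_C_mul, mul_smul_comm, map_smul, smul_eq_mul]
      _ = M.cInt fun c R => chargeDensity E U t c R * MvPolynomial.eval R (D.Pz (U.phi' t) c) := by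
          rw [← h2]
          simp only [chargeDensity, mul_comm]
      _ = M.cInt fun c R => E.epsPerp R * perpDot (U.phi t c) (U.phi' t c) R := by
          rw [h1, hU.poisson t ht _ hphi']
          simp only [mul_comm]
      _ = _ := by
          simp only [Mesh.cInt, Finset.mul_sum, ← MeasureTheory.integral_const_mul]
          refine Finset.sum_congr rfl fun c _ => ?_
          congr 1
          funext R
          ring
  -- the current density, tested with the time derivative of the vector potential
  have hcurrent : ∑ s, ∑ c, ∑ k, E.phaseInt c k (U.f' s t c k * Ham E D U s t c k) =
      -(2 * M.cInt fun c R => 1 / (2 * E.mu0) * perpDot (U.A t c) (U.A' t c) R) := by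
    have h1 := hU.ampere t ht _ hA'
    have h2 := E.cInt_mul_moment (fun s => E.q s / E.m s)
      (fun s c k => MvPolynomial.pderiv 3 (Ham E D U s t c k) * U.f s t c k) (U.A' t)
    have h3 : M.cInt (fun c R => MvPolynomial.eval R (U.A' t c) * Jpar E D U t c R) =
        ∑ s, E.q s / E.m s * ∑ c, ∑ k, E.phaseInt c k
          (MvPolynomial.pderiv 3 (Ham E D U s t c k) * U.f s t c k * emb (U.A' t c)) := by
      rw [← h2]
      simp only [Jpar, dvpar, map_mul, mul_assoc]
    have h4 : (2 * M.cInt fun c R => 1 / (2 * E.mu0) * perpDot (U.A t c) (U.A' t c) R) =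
        1 / E.mu0 * M.cInt fun c R => perpDot (U.A t c) (U.A' t c) R := by
      simp only [Mesh.cInt, Finset.mul_sum, ← MeasureTheory.integral_const_mul]
      refine Finset.sum_congr rfl fun c _ => ?_
      congr 1
      funext R
      field_simp
    rw [h4, h1, h3, ← mul_assoc, one_div_mul_cancel E.mu0_pos.ne', one_mul,
      ← Finset.sum_neg_distrib]
    exact Finset.sum_congr rfl fun s _ => sum_phaseInt_Ham_mul_deriv E D U (hH s)
      (hU.A_mem t ht) fun c k psi hpsi => hU.gyrokinetic s t ht c k psi hpsi
  simp only [Finset.sum_add_distrib]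
  rw [hcharge, hcurrent]
  ring

end Energies

end EMGK

theorem proposition3p2 {S : Type*} [Fintype S] (M : EMGK.Mesh S) (E : EMGK.Plasma M)
    (D : EMGK.Discretization M) (U : EMGK.Unknowns M) (I : Set ℝ) (hI : I.OrdConnected)
    (hU : EMGK.IsSolution E D U I)
    (hH : ∀ s, ∀ t ∈ I, EMGK.Ham E D U s t ∈ M.VhCont D.P s) :
    (∀ t ∈ I, HasDerivWithinAt (EMGK.energy E D U) 0 I t) ∧
      ∀ t₁ ∈ I, ∀ t₂ ∈ I, EMGK.energy E D U t₁ = EMGK.energy E D U t₂ := by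
  have hd : ∀ t ∈ I, HasDerivWithinAt (EMGK.energy E D U) 0 I t := by
    intro t ht
    by_cases hacc : AccPt t (Filter.principal I)
    · exact EMGK.hasDerivWithinAt_energy E D U hacc ht hU fun s => hH s t ht
    · -- an interval has an isolated point only if it is a single point
      exact HasFDerivWithinAt.of_not_accPt hacc
  refine ⟨hd, fun t₁ h₁ t₂ h₂ => ?_⟩
  have h := hI.convex.norm_image_sub_le_of_norm_hasDerivWithin_le (C := 0) hd
    (fun _ _ => by simp) h₂ h₁
  rw [zero_mul, norm_le_zero_iff] at h
  exact sub_eq_zero.1 h
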